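/- Let $n,k\ge 1$. For a group $W$ generated by a set $T$, let $\ell_T$ be the word length and let $\pi\le_T\mu$ mean $\ell_T(\mu)=\ell_T(\pi)+\ell_T(\pi^{-1}\mu)$; for $c\in W$ put $NC(W)=\{w: 1\le_T w\le_T c\}$, ordered by $\le_T$. Let $NC^{(k)}(W)$ be the set of $k$-multichains $(\pi)_k=(\pi_1\le_T\cdots\le_T\pi_k)$ in $NC(W)$, ordered by $(\pi)_k\le(\mu)_k$ iff $\mu_i^{-1}\mu_{i+1}\le_T\pi_i^{-1}\pi_{i+1}$ for all $1\le i\le k$, where $\pi_{k+1}=\mu_{k+1}=c$. Let $A_{N-1}$ be the symmetric group on $[N]=\{1,\dots,N\}$, with $T$ the set of transpositions and $c=(1\,2\cdots N)$. Identify $[\pm n]=\{1,\dots,n,-1,\dots,-n\}$ with $[2n]$ by $-i\leftrightarrow n+i$. Let $B_n\subset A_{2n-1}$ be the group of permutations of $[\pm n]$ commuting with $i\mapsto -i$, with $T$ the set of the permutations $(i,-i)$ and $(i,j)(-i,-j)$, $j\ne\pm i$, and with $c=(1,2,\dots,n,-1,\dots,-n)=(1\,2\cdots 2n)$. A partition of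 a finite linearly ordered set is noncrossing if there are no $a<b<c<d$ with $a,c$ in one block and $b,d$ in another; partitions are ordered by refinement. For partitions $\mathcal Q_1,\dots,\mathcal Q_k$ of $[N]$ let $\langle\mathcal Q_1,\dots,\mathcal Q_k\rangle$ be the partition of $[kN]$ that is the union of the translated dilations $k\mathcal Q_i-(k-i)$. The Kreweras complement $K(\mathcal P)$ of a noncrossing $\mathcal P$ is the coarsest $\mathcal Q$ with $\langle\mathcal P,\mathcal Q\rangle$ noncrossing (after relabelling the underlying set by $1,2,\dots$ in increasing order); $K$ is a bijection on noncrossing partitions. For $\mathcal P\le\mathcal R$ let $K^{\mathcal R}(\mathcal P)$ be the union, over the blocks $U$ of $\mathcal R$, of the Kreweras complements in $U$ of the restrictions $\mathcal P|U$. For a permutation $\pi$ let $\{\pi\}$ be its partition into orbits. The type $A$ map sends $(\pi)_k\in NC^{(k)}(A_{N-1})$ to $$K^{-1}\Big\langle K^{\{\pi_2\}}(\{\pi_1\}),\dots,K^{\{\pi_k\}}(\{\pi_{k-1}\}),K(\{\pi_k\})\Big\rangle .$$ **Theorem.** The inclusion $B_n\subset A_{2n-1}$ identifies $NC(B_n)$,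 with its order, with the sublattice of $NC(A_{2n-1})$ of elements fixed under conjugation by $c^n$, and correspondingly identifies $NC^{(k)}(B_n)$ with the induced subposet of $NC^{(k)}(A_{2n-1})$ of the multichains with all entries in this sublattice. The restriction of the type $A$ map (with $N=2n$) to $NC^{(k)}(B_n)$ is well defined (the partition to which $K^{-1}$ is applied is noncrossing) and is an isomorphism of posets from $NC^{(k)}(B_n)$ onto the set, ordered by refinement, of the noncrossing partitions of $[\pm kn]\cong[2kn]$ that are invariant under the antipodal map $x\mapsto x+kn \pmod{2kn}$ and all of whose blocks have cardinality divisible by $k$. -/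

import Mathlib

namespace KDiv

/-! ### Absolute order, algebraic (`k`-divisible) noncrossing partitions -/

section Algebraic

variable {G : Type*} [Group G]

/-- The word length `ℓ_T(w)`: least length of a word in the letters `T` with product `w`. -/
noncomputable def wordLength (T : Set G) (w : G) : ℕ :=
  sInf {r : ℕ | ∃ l : List G, (∀ t ∈ l, t ∈ T) ∧ l.length = r ∧ l.prod = w}

/-- The absolute order: `π ≤_T μ` iff `ℓ_T(μ) = ℓ_T(π) + ℓ_T(π⁻¹ μ)`. -/
def AbsLE (T : Set G) (π μ : G) : Prop :=
  wordLength T μ = wordLength T π + wordLength T (π⁻¹ * μ)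

/-- The poset `NC(W, c)`: the interval `[1, c]` in the absolute order. -/
def NCGroup (T : Set G) (c : G) : Type _ := {w : G // AbsLE T 1 w ∧ AbsLE T w c}

/-- The order of `NC(W, c)` is the absolute order. -/
instance (T : Set G) (c : G) : LE (NCGroup T c) := ⟨fun u v => AbsLE T u.1 v.1⟩

/-- The `k`-multichains `π₁ ≤ π₂ ≤ ⋯ ≤ π_k` in `NC(W, c)`: the underlying set of `NC^{(k)}(W)`. -/
def NCGroupDiv (T : Set G) (c : G) (k : ℕ) : Type _ :=
  {π : Fin k → NCGroup T c // ∀ i j : Fin k, i ≤ j → π i ≤ π j}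

/-- The delta sequence `∂(π)_k = (π₁⁻¹ π₂, …, π_{k-1}⁻¹ π_k, π_k⁻¹ c)` of a multichain. -/
def delta {T : Set G} {c : G} {k : ℕ} (π : NCGroupDiv T c k) (i : Fin k) : G :=
  (π.1 i).1⁻¹ * (if h : (i : ℕ) + 1 < k then (π.1 ⟨i + 1, h⟩).1 else c)

/-- The order of `NC^{(k)}(W)`: `π ≤ μ` iff `∂μ ≤_T ∂π` componentwise. -/
instance (T : Set G) (c : G) (k : ℕ) : LE (NCGroupDiv T c k) :=
  ⟨fun π μ => ∀ i : Fin k, AbsLE T (delta μ i) (delta π i)⟩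

end Algebraic

/-! ### The symmetric group `A_{N-1}` and the group `B_n` of signed permutations -/

/-- The `N`-cycle `(1 2 ⋯ N)` on `[N]`; the point `i` of `Fin N` stands for `i + 1 ∈ [N]`. -/
def cyc (N : ℕ) : Equiv.Perm (Fin N) := finRotate N

/-- The reflections of the symmetric group: the transpositions. -/
def reflA (N : ℕ) : Set (Equiv.Perm (Fin N)) := {t | t.IsSwap}

/-- The half-turn of the `N`-gon, for even `N`. For `N = 2 * n` we label the points
`1, 2, …, n, -1, -2, …, -n` in this order, so that `[2n]` becomes `[±n]` and the half-turn is the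
antipodal permutation `i ↦ -i`. -/
def antipode (N : ℕ) : Equiv.Perm (Fin N) := finRotate N ^ (N / 2)

/-- `B_n`: the permutations of `[±n]` that commute with the antipodal permutation. -/
def signedPerm (n : ℕ) : Subgroup (Equiv.Perm (Fin (2 * n))) :=
  Subgroup.centralizer {antipode (2 * n)}

/-- The reflections of `B_n`: the permutations `(i, -i)`, and `(i, j)(-i, -j)` with `j ≠ ±i`. -/
def reflB (n : ℕ) : Set (signedPerm n) :=
  {t | (∃ i, t.1 = Equiv.swap i (antipode _ i)) ∨
    ∃ i j, j ≠ i ∧ j ≠ antipode _ i ∧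
      t.1 = Equiv.swap i j * Equiv.swap (antipode _ i) (antipode _ j)}

/-- The Coxeter element `(1, 2, …, n, -1, -2, …, -n)` of `B_n`. -/
def cycB (n : ℕ) : signedPerm n :=
  ⟨cyc (2 * n), by
    rw [signedPerm, Subgroup.mem_centralizer_singleton_iff]
    exact ((Commute.refl (finRotate (2 * n))).pow_right (2 * n / 2)).eq⟩

/-! ### Classical noncrossing partitions; partitions are equivalence relations, ordered by
refinement -/

section Classical

variable {X : Type*} [LinearOrder X]

/-- A partition of a linearly ordered set is noncrossing if there are no `a < b < c < d` with
`a, c` in one block and `b, d` in another block. -/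
def Noncrossing (P : Setoid X) : Prop :=
  ∀ a b c d : X, a < b → b < c → c < d → P a c → P b d → P a b

/-- The shuffle `⟨Q₁, …, Q_k⟩` of `k` partitions of `X`: the partition of `k` interleaved copies
`x₁ < ⋯ < x_k < y₁ < ⋯ < y_k < ⋯` of `X = {x < y < ⋯}` that is `Q_i` on the `i`-th copy. -/
def shuffle {k : ℕ} (Q : Fin k → Setoid X) : Setoid (X ×ₗ Fin k) where
  r p q := (ofLex p).2 = (ofLex q).2 ∧ Q (ofLex p).2 (ofLex p).1 (ofLex q).1
  iseqv :=
    { refl := fun _ => ⟨rfl, Setoid.refl' _ _⟩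
      symm := fun h => ⟨h.1.symm, h.1 ▸ Setoid.symm' _ h.2⟩
      trans := fun h h' => ⟨h.1.trans h'.1, Setoid.trans' _ h.2 (by rw [h.1]; exact h'.2)⟩ }

/-- The Kreweras complement `K(P)`: the coarsest partition `Q` such that the interleaving
`⟨P, Q⟩` is noncrossing. -/
noncomputable def kreweras (P : Setoid X) : Setoid X :=
  sSup {Q : Setoid X | Noncrossing (shuffle ![P, Q])}

/-- The relative Kreweras complement `K^R(P)`, for `P ≤ R`: the union over the blocks `U` of `R` of
the Kreweras complements in `U` of the restrictions `P|U`. -/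
noncomputable def relKreweras (R P : Setoid X) : Setoid X where
  r x y := ∃ U ∈ R.classes, ∃ (hx : x ∈ U) (hy : y ∈ U),
    kreweras (P.comap (Subtype.val : U → X)) ⟨x, hx⟩ ⟨y, hy⟩
  iseqv :=
    { refl := fun x => ⟨_, R.mem_classes x, R.refl' x, R.refl' x, Setoid.refl' _ _⟩
      symm := fun ⟨U, hU, hx, hy, h⟩ => ⟨U, hU, hy, hx, Setoid.symm' _ h⟩
      trans := by
        rintro x y z ⟨U, hU, hx, hy, h⟩ ⟨V, hV, hy', hz, h'⟩
        obtain rfl := Setoid.eq_of_mem_classes hU hy hV hy'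
        exact ⟨U, hU, hx, hz, Setoid.trans' _ h h'⟩ }

/-- The explicit form of the coarsest partition whose interleaving with `P` is noncrossing: `i` and
`j` are together iff the half-open interval between them is a union of blocks of `P`. -/
def krewerasAux (P : Setoid X) : Setoid X where
  r i j := ∀ a b, P a b → ((a ≤ i ↔ a ≤ j) ↔ (b ≤ i ↔ b ≤ j))
  iseqv :=
    { refl := fun _ _ _ _ => by tauto
      symm := fun h a b hab => by have := h a b hab; tauto
      trans := fun h h' a b hab => by have := h a b hab; have := h' a b hab; tauto }

theorem four_chain {p₁ p₂ p₃ p₄ q₁ q₂ q₃ q₄ : Prop} (hp₁ : p₁ → p₂) (hp₂ : p₂ → p₃)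
    (hp₃ : p₃ → p₄) (hq₁ : q₁ → q₂) (hq₂ : q₂ → q₃) (hq₃ : q₃ → q₄)
    (h : (p₁ ↔ p₃) ↔ (q₁ ↔ q₃)) (h' : (p₂ ↔ p₄) ↔ (q₂ ↔ q₄)) :
    (p₁ ↔ p₂) ↔ (q₁ ↔ q₂) := by
  by_cases p₁ <;> by_cases p₂ <;> by_cases p₃ <;> by_cases p₄ <;> simp_all <;>
  by_cases q₁ <;> by_cases q₂ <;> by_cases q₃ <;> simp_all

theorem two_chain {p q p' q' : Prop} (e : p → q) (e' : p' → q')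
    (h : ¬ p → q → ¬ p' ∧ q') (h' : ¬ p' → q' → ¬ p ∧ q) : (p ↔ q) ↔ (p' ↔ q') := by
  tauto

/-- For noncrossing `P` there is a coarsest `Q` such that `⟨P, Q⟩` is noncrossing. -/
theorem isGreatest_krewerasAux {P : Setoid X} (hP : Noncrossing P) :
    IsGreatest {Q : Setoid X | Noncrossing (shuffle ![P, Q])} (krewerasAux P) := by
  have hlt : ∀ p q : X ×ₗ Fin 2, p < q ↔
      (ofLex p).1 < (ofLex q).1 ∨ (ofLex p).1 = (ofLex q).1 ∧ (ofLex p).2 < (ofLex q).2 :=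
    fun _ _ => Prod.Lex.lt_iff
  constructor
  · intro p q r s hpq hqr hrs hpr hqs
    rw [hlt] at hpq hqr hrs
    obtain ⟨x, i⟩ := p
    obtain ⟨y, j⟩ := q
    obtain ⟨z, i'⟩ := r
    obtain ⟨w, j'⟩ := s
    obtain ⟨h1, hpr⟩ := hpr
    obtain ⟨h2, hqs⟩ := hqs
    simp only [ofLex] at *
    change i = i' at h1
    change j = j' at h2
    subst h1 h2
    change (![P, krewerasAux P] i) x z at hpr
    change (![P, krewerasAux P] j) y w at hqs
    change i = j ∧ (![P, krewerasAux P] i) x y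
    change x < y ∨ x = y ∧ i < j at hpq
    change y < z ∨ y = z ∧ j < i at hqr
    change z < w ∨ z = w ∧ i < j at hrs
    match i, j with
    | 0, 0 =>
      simp at hpq hqr hrs hpr hqs ⊢
      exact hP x y z w hpq hqr hrs hpr hqs
    | 1, 1 =>
      simp at hpq hqr hrs hpr hqs ⊢
      intro a b hab
      exact four_chain (fun h => h.trans hpq.le) (fun h => h.trans hqr.le)
        (fun h => h.trans hrs.le) (fun h => h.trans hpq.le) (fun h => h.trans hqr.le)
        (fun h => h.trans hrs.le) (hpr a b hab) (hqs a b hab)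
    | 0, 1 =>
      exfalso
      simp at hpq hqr hrs hpr hqs
      have h3 := hqs x z hpr
      have hrs : z ≤ w := le_iff_lt_or_eq.2 hrs
      have e1 : x ≤ y := le_iff_lt_or_eq.2 hpq
      have e2 : x ≤ w := (e1.trans hqr.le).trans hrs
      have e3 : ¬ z ≤ y := not_le.2 hqr
      have e4 : z ≤ w := hrs
      tauto
    | 1, 0 =>
      exfalso
      simp at hpq hqr hrs hpr hqs
      have h3 := hpr y w hqs
      have e1 : ¬ y ≤ x := not_le.2 hpq
      have hqr : y ≤ z := le_iff_lt_or_eq.2 hqr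
      have e2 : y ≤ z := hqr
      have e3 : ¬ w ≤ x := not_le.2 ((hpq.trans_le hqr).trans hrs)
      have e4 : ¬ w ≤ z := not_le.2 hrs
      tauto
  · intro Q hQ
    have key : ∀ i j a b, i < j → Q i j → P a b → a ≤ j → ¬ a ≤ i → b ≤ j ∧ ¬ b ≤ i := by
      intro i j a b hij hQij hab h1 h2
      rw [not_le] at h2
      by_contra hcon
      rcases le_or_gt b i with h3 | h3
      · have := hQ (toLex (b, 0)) (toLex (i, 1)) (toLex (a, 0)) (toLex (j, 1))
          ((hlt _ _).2 (by rcases h3.lt_or_eq with h | h <;> simp [h]))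
          ((hlt _ _).2 (by simp [h2]))
          ((hlt _ _).2 (by rcases h1.lt_or_eq with h | h <;> simp [h]))
          ⟨rfl, P.symm' hab⟩ ⟨rfl, hQij⟩
        exact absurd this.1 (by simp)
      · have h4 : j < b := by
          by_contra h4
          exact hcon ⟨not_lt.1 h4, not_le.2 h3⟩
        have := hQ (toLex (i, 1)) (toLex (a, 0)) (toLex (j, 1)) (toLex (b, 0))
          ((hlt _ _).2 (by simp [h2]))
          ((hlt _ _).2 (by rcases h1.lt_or_eq with h | h <;> simp [h]))
          ((hlt _ _).2 (by simp [h4]))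
          ⟨rfl, hQij⟩ ⟨rfl, hab⟩
        exact absurd this.1 (by simp)
    have key2 : ∀ i j, i < j → Q i j → krewerasAux P i j := by
      intro i j hij hQij a b hab
      have h1 := key i j a b hij hQij hab
      have h2 := key i j b a hij hQij (P.symm' hab)
      have e1 : a ≤ i → a ≤ j := fun h => h.trans hij.le
      have e2 : b ≤ i → b ≤ j := fun h => h.trans hij.le
      tauto
    intro i j hQij
    rcases lt_trichotomy i j with h | h | h
    · exact key2 i j h hQij
    · rw [h]
    · exact (krewerasAux P).symm' (key2 j i h (Q.symm' hQij))

theorem kreweras_eq {P : Setoid X} (hP : Noncrossing P) : kreweras P = krewerasAux P :=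
  (isGreatest_krewerasAux hP).isLUB.sSup_eq

theorem noncrossing_kreweras {P : Setoid X} (hP : Noncrossing P) : Noncrossing (kreweras P) := by
  rw [kreweras_eq hP]
  intro a b c d hab hbc hcd hac hbd x y hxy
  exact four_chain (fun h => h.trans hab.le) (fun h => h.trans hbc.le)
    (fun h => h.trans hcd.le) (fun h => h.trans hab.le) (fun h => h.trans hbc.le)
    (fun h => h.trans hcd.le) (hac x y hxy) (hbd x y hxy)

/-- A noncrossing partition can be recovered from its Kreweras complement. -/
theorem rel_iff_of_noncrossing [Finite X] {P : Setoid X} (hP : Noncrossing P) (i j : X) :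
    P i j ↔ ∀ u v, krewerasAux P u v → ((i ≤ u ↔ i ≤ v) ↔ (j ≤ u ↔ j ≤ v)) := by
  refine ⟨fun h u v huv => huv i j h, fun h => ?_⟩
  have key : ∀ i j, i < j →
      (∀ u v, krewerasAux P u v → ((i ≤ u ↔ i ≤ v) ↔ (j ≤ u ↔ j ≤ v))) → P i j := by
    clear h i j
    intro i j hij h
    by_contra hn
    -- the largest element of the block of `i` below `j`
    obtain ⟨m, ⟨him, hmj⟩, hm⟩ := Set.exists_max_image {x | P i x ∧ x < j} id (Set.toFinite _)
      ⟨i, P.refl' i, hij⟩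
    have hm : ∀ x, P i x → x < j → x ≤ m := fun x h1 h2 => hm x ⟨h1, h2⟩
    have himle : i ≤ m := hm i (P.refl' i) hij
    by_cases hex : ∃ x, P i x ∧ j < x
    · obtain ⟨m', ⟨him', hjm'⟩, hm'⟩ := Set.exists_min_image {x | P i x ∧ j < x} id
        (Set.toFinite _) hex
      have hm' : ∀ x, P i x → j < x → m' ≤ x := fun x h1 h2 => hm' x ⟨h1, h2⟩
      obtain ⟨v, hv, hvm⟩ := Set.exists_max_image {x | x < m'} id (Set.toFinite _) ⟨j, hjm'⟩
      have hvm : ∀ x, x < m' ↔ x ≤ v := fun x => ⟨fun hx => hvm x hx, fun hx => hx.trans_lt hv⟩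
      have hnb : ∀ x, m < x → x < m' → ¬ P i x := by
        intro x h1 h2 h3
        rcases lt_trichotomy x j with h4 | h4 | h4
        · exact absurd (hm x h3 h4) (not_le.2 h1)
        · exact hn (h4 ▸ h3)
        · exact absurd (hm' x h3 h4) (not_le.2 h2)
      have hcl : ∀ x y, P x y → m < x → x < m' → m < y ∧ y < m' := by
        intro x y hxy h1 h2
        have hx := hnb x h1 h2
        have hy : ¬ P i y := fun h3 => hx (P.trans' h3 (P.symm' hxy))
        by_contra hcon
        rcases lt_trichotomy y m with h3 | h3 | h3
        · have := hP y m x m' h3 h1 h2 (P.symm' hxy) (P.trans' (P.symm' him) him')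
          exact hy (P.trans' him (P.symm' this))
        · exact hy (h3 ▸ him)
        · rcases lt_trichotomy y m' with h4 | h4 | h4
          · exact hcon ⟨h3, h4⟩
          · exact hy (h4 ▸ him')
          · have := hP m x m' y h1 h2 h4 (P.trans' (P.symm' him) him') hxy
            exact hx (P.trans' him this)
      have hK : krewerasAux P m v := by
        intro a b hab
        have h1 := hcl a b hab
        have h2 := hcl b a (P.symm' hab)
        rw [hvm, hvm] at h1 h2
        rw [← not_le, ← not_le] at h1 h2
        have hmv : m ≤ v := (hvm m).1 (hmj.trans hjm')
        exact two_chain (fun h => h.trans hmv) (fun h => h.trans hmv) h1 h2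
      have h1 := h m v hK
      have e1 : i ≤ v := (hvm i).1 (hij.trans hjm')
      have e2 : j ≤ v := (hvm j).1 hjm'
      have e3 : ¬ j ≤ m := not_le.2 hmj
      simp [e1, e2, e3, himle] at h1
    · have hle : ∀ x, P i x → x ≤ m := by
        intro x hx
        rcases lt_trichotomy x j with h4 | h4 | h4
        · exact hm x hx h4
        · exact absurd (h4 ▸ hx) hn
        · exact absurd ⟨x, hx, h4⟩ hex
      obtain ⟨m₀, him₀, hm₀⟩ := Set.exists_min_image {x | P i x} id (Set.toFinite _)
        ⟨i, P.refl' i⟩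
      have hm₀ : ∀ x, P i x → m₀ ≤ x := fun x hx => hm₀ x hx
      have him₀ : P i m₀ := him₀
      have hcl : ∀ x y, P x y → m₀ ≤ x → x ≤ m → m₀ ≤ y ∧ y ≤ m := by
        intro x y hxy h1 h2
        by_cases hx : P i x
        · have hy := P.trans' hx hxy
          exact ⟨hm₀ y hy, hle y hy⟩
        have hy : ¬ P i y := fun h3 => hx (P.trans' h3 (P.symm' hxy))
        have h1 : m₀ < x := lt_of_le_of_ne h1 (fun h => hx (h ▸ him₀))
        have h2 : x < m := lt_of_le_of_ne h2 (fun h => hx (h ▸ him))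
        by_contra hcon
        rcases lt_or_ge y m₀ with h3 | h3
        · have := hP y m₀ x m h3 h1 h2 (P.symm' hxy) (P.trans' (P.symm' him₀) him)
          exact hy (P.trans' him₀ (P.symm' this))
        · have h4 : m < y := lt_of_not_ge fun h4 => hcon ⟨h3, h4⟩
          have := hP m₀ x m y h1 h2 h4 (P.trans' (P.symm' him₀) him) hxy
          exact hx (P.trans' him₀ this)
      have hm₀i : m₀ ≤ i := hm₀ i (P.refl' i)
      by_cases hbot : ∃ x, x < m₀
      · obtain ⟨u, hu, hum⟩ := Set.exists_max_image {x | x < m₀} id (Set.toFinite _) hbot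
        have hum : ∀ x, x < m₀ ↔ x ≤ u := fun x => ⟨fun hx => hum x hx, fun hx => hx.trans_lt hu⟩
        have hK : krewerasAux P u m := by
          intro a b hab
          have h1 := hcl a b hab
          have h2 := hcl b a (P.symm' hab)
          have hmu : u ≤ m := (hu.le.trans hm₀i).trans himle
          refine two_chain (fun h => h.trans hmu) (fun h => h.trans hmu)
            (fun g g' => ?_) (fun g g' => ?_)
          · rw [← hum, not_lt] at g ⊢
            exact h1 g g'
          · rw [← hum, not_lt] at g ⊢
            exact h2 g g'
        have h1 := h u m hK
        have e1 : ¬ i ≤ u := fun h => absurd ((hum i).2 h) (not_lt.2 hm₀i)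
        have e2 : ¬ j ≤ u := fun h => absurd ((hum j).2 h) (not_lt.2 (hm₀i.trans hij.le))
        have e3 : ¬ j ≤ m := not_le.2 hmj
        simp [e1, e2, e3, himle] at h1
      · obtain ⟨t, -, ht⟩ := Set.exists_max_image (Set.univ : Set X) id (Set.toFinite _)
          ⟨i, trivial⟩
        have ht : ∀ x, x ≤ t := fun x => ht x trivial
        have hK : krewerasAux P m t := by
          intro a b hab
          have h1 := hcl a b hab
          have h2 := hcl b a (P.symm' hab)
          have e1 : m₀ ≤ a := not_lt.1 fun h => hbot ⟨a, h⟩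
          have e2 : m₀ ≤ b := not_lt.1 fun h => hbot ⟨b, h⟩
          have f1 : a ≤ m ↔ b ≤ m := ⟨fun g => (h1 e1 g).2, fun g => (h2 e2 g).2⟩
          simp [ht, f1]
        have h1 := h m t hK
        have e3 : ¬ j ≤ m := not_le.2 hmj
        simp [ht, e3, himle] at h1
  rcases lt_trichotomy i j with h1 | h1 | h1
  · exact key i j h1 h
  · rw [h1]
  · exact P.symm' (key j i h1 fun u v huv => (h u v huv).symm)

theorem kreweras_injOn [Finite X] : Set.InjOn (kreweras (X := X)) {P | Noncrossing P} := by
  intro P hP Q hQ h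
  rw [kreweras_eq hP, kreweras_eq hQ] at h
  ext i j
  rw [rel_iff_of_noncrossing hP, rel_iff_of_noncrossing hQ, h]

/-- The Kreweras complement is a bijection of the set of noncrossing partitions onto itself. -/
theorem kreweras_bijOn [Finite X] :
    Set.BijOn (kreweras (X := X)) {P | Noncrossing P} {P | Noncrossing P} := by
  have hfin : Finite (Setoid X) :=
    Finite.of_injective (fun r : Setoid X => r.r) fun _ _ h => Setoid.ext fun a b => by
      have := congrFun (congrFun h a) b
      exact iff_of_eq this
  have hmaps : Set.MapsTo (kreweras (X := X)) {P | Noncrossing P} {P | Noncrossing P} :=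
    fun _ hP => noncrossing_kreweras hP
  exact ⟨hmaps, kreweras_injOn,
    ((Set.toFinite _).injOn_iff_bijOn_of_mapsTo hmaps).1 kreweras_injOn |>.surjOn⟩

/-- The inverse `K⁻¹` of the bijection `K` of the set of noncrossing partitions onto itself. -/
noncomputable def krewerasInv (Q : Setoid X) : Setoid X :=
  Function.invFunOn kreweras {P : Setoid X | Noncrossing P} Q

end Classical

/-- The shuffle of `k` partitions of `[m]` as a partition of `[mk]`: the `i`-th copy of `j ∈ [m]`
is `kj - (k - i) ∈ [mk]`. -/
def shuffleFin {m k : ℕ} (Q : Fin k → Setoid (Fin m)) : Setoid (Fin (m * k)) :=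
  (shuffle Q).comap fun x => toLex (x.divNat, x.modNat)

/-- The classical delta sequence
`∂(P)_k = (K^{P₂}(P₁), …, K^{P_k}(P_{k-1}), K(P_k))`. -/
noncomputable def classicalDelta {X : Type*} [LinearOrder X] {k : ℕ} (P : Fin k → Setoid X)
    (i : Fin k) : Setoid X :=
  if h : (i : ℕ) + 1 < k then relKreweras (P ⟨i + 1, h⟩) (P i) else kreweras (P i)

/-- The partition `{π}` of `[N]` into the orbits of the permutation `π`. -/
def orbitPartition {N : ℕ} (π : Equiv.Perm (Fin N)) : Setoid (Fin N) :=
  Equiv.Perm.SameCycle.setoid π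

/-- The shuffle `⟨∂({π})_k⟩` for a multichain `π` in `NC(A_{N-1})`. -/
noncomputable def shuffleDelta {N k : ℕ} (π : NCGroupDiv (reflA N) (cyc N) k) :
    Setoid (Fin (N * k)) :=
  shuffleFin (classicalDelta fun i => orbitPartition (π.1 i).1)

/-- The type `A` map `(π)_k ↦ K⁻¹⟨∂({π})_k⟩`. -/
noncomputable def nabla {N k : ℕ} (π : NCGroupDiv (reflA N) (cyc N) k) : Setoid (Fin (N * k)) :=
  krewerasInv (shuffleDelta π)

/-- Every block has cardinality divisible by `k`. -/
def Divisible {N : ℕ} (k : ℕ) (P : Setoid (Fin N)) : Prop := ∀ B ∈ P.classes, k ∣ B.ncard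

/-- Invariance under the antipodal map (half-turn). -/
def CentrallySymmetric {N : ℕ} (P : Setoid (Fin N)) : Prop :=
  ∀ x y, P (antipode N x) (antipode N y) ↔ P x y

/-- The centrally symmetric noncrossing partitions of `[±kn]` all of whose blocks have
cardinality divisible by `k`, ordered by refinement. -/
abbrev NCSymDiv (n k : ℕ) : Type :=
  {P : Setoid (Fin (2 * n * k)) // Noncrossing P ∧ CentrallySymmetric P ∧ Divisible k P}

end KDiv

open KDiv

/-!
Everything is read off from spaces of fixed functions. The reflection length of a permutation `w` of
`[N]` is the codimension of the space of functions on `[N]` fixed by `w`, and for `w` in `B_n` it is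
the codimension inside the space of odd functions, those with `f (-i) = - f i`. Hence `u ≤ v` makes
the functions fixed by `v` split according to `u` and `u⁻¹ v`. Applied to indicators of initial
segments, this shows that for `u ≤ v ≤ c` the orbits of `u⁻¹ v` form the relative Kreweras
complement of the orbits of `u`. Every noncrossing partition is the orbit partition of exactly one
`u ≤ c`, the absolute order becoming refinement and conjugation by powers of `c` becoming rotation.

For a `k`-tuple `π` let `δ` be the shuffle of the permutations `π₁⁻¹ π₂, …, π_k⁻¹ c`. Then the type
`A` map is `π ↦ {c δ⁻¹}`. Conjugating by the shuffle of `π` itself straightens `c δ⁻¹` into the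
permutation that passes through the `k` copies of each point in turn and then applies `π₁`, so
`c δ⁻¹` has as many cycles as `π₁`. Counting cycles, `π` is a multichain iff `c δ⁻¹ ≤ c`. The blocks
of `{w}`, `w ≤ c`, have size divisible by `k` iff `w⁻¹ c` preserves residues modulo `k`, that is,
iff it is a shuffle, and `{w}` is centrally symmetric iff `w` commutes with the half-turn.

Finally, an element of `B_n` below `c` or in a delta sequence has at most one cycle that is stable
under `i ↦ -i`. By a parity argument, this forces additivity of lengths in `B_n` to be additivity
of lengths in `A_{2n-1}`, so the orders on the type `B` side are induced from type `A`.
-/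

namespace KDiv

open Module Equiv.Perm

/-! ### Functions fixed by a permutation -/

section FixedSpace

variable {X Y : Type*}

theorem sameCycle_setoid_le_iff {w : Equiv.Perm X} {P : Setoid X} :
    SameCycle.setoid w ≤ P ↔ ∀ x, P x (w x) := by
  refine ⟨fun h x => h (sameCycle_apply_right.2 (SameCycle.refl w x)), ?_⟩
  rintro h x _ ⟨i, rfl⟩
  induction i with
  | zero => exact P.refl' x
  | succ i ih =>
    rw [add_comm, zpow_add, zpow_one, Equiv.Perm.mul_apply]
    exact P.trans' ih (h _)
  | pred i ih =>
    rw [sub_eq_neg_add, zpow_add, zpow_neg_one, Equiv.Perm.mul_apply]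
    refine P.trans' ih (P.symm' ?_)
    simpa using h (w⁻¹ ((w ^ (-(i : ℤ))) x))

/-- The space of rational functions that are fixed by `w`, that is, constant on its cycles. -/
def fixedSpace (w : Equiv.Perm X) : Submodule ℚ (X → ℚ) where
  carrier := {f | ∀ x, f (w x) = f x}
  add_mem' hf hg x := by simp [hf x, hg x]
  zero_mem' _ := rfl
  smul_mem' a f hf x := by simp [hf x]

theorem mem_fixedSpace {w : Equiv.Perm X} {f : X → ℚ} :
    f ∈ fixedSpace w ↔ ∀ x, f (w x) = f x := Iff.rfl

theorem fixedSpace_inf_le_mul (u v : Equiv.Perm X) :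
    fixedSpace u ⊓ fixedSpace v ≤ fixedSpace (u * v) :=
  fun _ hf x => (hf.1 (v x)).trans (hf.2 x)

theorem eq_of_sameCycle {w : Equiv.Perm X} {f : X → ℚ} (hf : f ∈ fixedSpace w) {x y : X}
    (h : w.SameCycle x y) : f x = f y :=
  sameCycle_setoid_le_iff (P := Setoid.ker f).2 (fun z => (hf z).symm) h

theorem sameCycle_of_forall_fixedSpace {w : Equiv.Perm X} {x y : X}
    (h : ∀ f ∈ fixedSpace w, f x = f y) : w.SameCycle x y := by
  classical
  have hf : (fun z => if w.SameCycle x z then (1 : ℚ) else 0) ∈ fixedSpace w := fun z => by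
    simp only [sameCycle_apply_right]
  by_contra hn
  simpa [hn, SameCycle.refl] using h _ hf

theorem fixedSpace_le_iff {u v : Equiv.Perm X} :
    fixedSpace v ≤ fixedSpace u ↔ SameCycle.setoid u ≤ SameCycle.setoid v :=
  ⟨fun h _ _ hxy => sameCycle_of_forall_fixedSpace fun _ hf => eq_of_sameCycle (h hf) hxy,
    fun h _ hf x => (eq_of_sameCycle hf (sameCycle_setoid_le_iff.1 h x)).symm⟩

theorem mem_fixedSpace_swap [DecidableEq X] {i j : X} {f : X → ℚ} (h : f i = f j) :
    f ∈ fixedSpace (Equiv.swap i j) := fun x => by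
  rw [Equiv.swap_apply_def]
  split_ifs with hi hj
  · rw [hi, h]
  · rw [hj, h]
  · rfl

theorem single_mem_fixedSpace [DecidableEq X] {w : Equiv.Perm X} {x : X} (hx : w x = x) :
    (Pi.single x 1 : X → ℚ) ∈ fixedSpace w := fun z => by
  have : w z = x ↔ z = x := by rw [← w.injective.eq_iff (a := z), hx]
  simp only [Pi.single_apply, this]

theorem finrank_fixedSpace_permCongr (e : X ≃ Y) (w : Equiv.Perm X) :
    finrank ℚ (fixedSpace (e.permCongr w)) = finrank ℚ (fixedSpace w) := by
  have : fixedSpace w = (fixedSpace (e.permCongr w)).map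
      (LinearEquiv.funCongrLeft ℚ ℚ e : (Y → ℚ) →ₗ[ℚ] (X → ℚ)) := by
    ext f
    constructor
    · intro hf
      exact ⟨f ∘ e.symm, fun x => by simpa using hf (e.symm x), by ext x; simp⟩
    · rintro ⟨g, hg, rfl⟩ x
      simpa using hg (e x)
  rw [this, LinearEquiv.finrank_map_eq]

/-- The codimension in `V` of the functions in `V` that are fixed by `w`. For `V = ⊤` it is the
word length of `w` in the transpositions. -/
noncomputable def fixedCodim (V : Submodule ℚ (X → ℚ)) (w : Equiv.Perm X) : ℕ :=
  finrank ℚ V - finrank ℚ (fixedSpace w ⊓ V : Submodule ℚ (X → ℚ))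

@[simp]
theorem fixedCodim_one (V : Submodule ℚ (X → ℚ)) : fixedCodim V (1 : Equiv.Perm X) = 0 := by
  have h : fixedSpace (1 : Equiv.Perm X) = ⊤ := eq_top_iff.2 fun f _ x => rfl
  rw [fixedCodim, h, top_inf_eq, Nat.sub_self]

variable [Finite X]

theorem fixedCodim_add_finrank (V : Submodule ℚ (X → ℚ)) (w : Equiv.Perm X) :
    fixedCodim V w + finrank ℚ (fixedSpace w ⊓ V : Submodule ℚ (X → ℚ)) = finrank ℚ V :=
  Nat.sub_add_cancel (Submodule.finrank_mono inf_le_right)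

theorem fixedCodim_top_add_finrank (w : Equiv.Perm X) :
    fixedCodim ⊤ w + finrank ℚ (fixedSpace w) = Nat.card X := by
  have := Fintype.ofFinite X
  have := fixedCodim_add_finrank ⊤ w
  rwa [inf_top_eq, finrank_top, finrank_fintype_fun_eq_card, ← Nat.card_eq_fintype_card] at this

theorem fixedCodim_mul_le (V : Submodule ℚ (X → ℚ)) (u v : Equiv.Perm X) :
    fixedCodim V (u * v) ≤ fixedCodim V u + fixedCodim V v := by
  have hsum := Submodule.finrank_sup_add_finrank_inf_eq (fixedSpace u ⊓ V) (fixedSpace v ⊓ V)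
  have hsup : finrank ℚ ((fixedSpace u ⊓ V) ⊔ (fixedSpace v ⊓ V) : Submodule ℚ (X → ℚ)) ≤
      finrank ℚ V :=
    Submodule.finrank_mono (sup_le inf_le_right inf_le_right)
  have hinf : finrank ℚ ((fixedSpace u ⊓ V) ⊓ (fixedSpace v ⊓ V) : Submodule ℚ (X → ℚ)) ≤
      finrank ℚ (fixedSpace (u * v) ⊓ V : Submodule ℚ (X → ℚ)) := by
    rw [← inf_inf_distrib_right]
    exact Submodule.finrank_mono (inf_le_inf_right V (fixedSpace_inf_le_mul u v))
  have := fixedCodim_add_finrank V u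
  have := fixedCodim_add_finrank V v
  have := fixedCodim_add_finrank V (u * v)
  omega

theorem fixedCodim_le_one {V : Submodule ℚ (X → ℚ)} {t : Equiv.Perm X} (i j : X)
    (h : ∀ f ∈ V, f i = f j → f ∈ fixedSpace t) : fixedCodim V t ≤ 1 := by
  let φ : V →ₗ[ℚ] ℚ := ((LinearMap.proj i : (X → ℚ) →ₗ[ℚ] ℚ) - LinearMap.proj j).comp V.subtype
  have hrank := φ.finrank_range_add_finrank_ker
  have hrange : finrank ℚ φ.range ≤ 1 := (Submodule.finrank_le _).trans (finrank_self ℚ).le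
  have hker : finrank ℚ φ.ker ≤ finrank ℚ (fixedSpace t ⊓ V : Submodule ℚ (X → ℚ)) := by
    rw [← Submodule.finrank_map_subtype_eq V φ.ker]
    refine Submodule.finrank_mono ?_
    rintro _ ⟨f, hf, rfl⟩
    exact ⟨h _ f.2 (sub_eq_zero.1 hf), f.2⟩
  have := fixedCodim_add_finrank V t
  omega

theorem fixedCodim_lt {V : Submodule ℚ (X → ℚ)} {u w : Equiv.Perm X}
    (h : fixedSpace w ⊓ V ≤ fixedSpace u) {f : X → ℚ} (hf : f ∈ V) (hu : f ∈ fixedSpace u)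
    (hw : f ∉ fixedSpace w) : fixedCodim V u < fixedCodim V w := by
  have hlt : fixedSpace w ⊓ V < fixedSpace u ⊓ V :=
    lt_of_le_of_ne (le_inf h inf_le_right) fun he => hw (he.ge ⟨hu, hf⟩).1
  have := Submodule.finrank_lt_finrank_of_lt hlt
  have := fixedCodim_add_finrank V u
  have := fixedCodim_add_finrank V w
  omega

theorem fixedCodim_permCongr [Finite Y] (e : X ≃ Y) (w : Equiv.Perm X) :
    fixedCodim ⊤ (e.permCongr w) = fixedCodim ⊤ w := by
  have := fixedCodim_top_add_finrank w
  have := fixedCodim_top_add_finrank (e.permCongr w)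
  have := finrank_fixedSpace_permCongr e w
  have := Nat.card_congr e
  omega

theorem fixedCodim_conj (g w : Equiv.Perm X) :
    fixedCodim ⊤ (g * w * g⁻¹) = fixedCodim ⊤ w :=
  fixedCodim_permCongr g w

end FixedSpace

/-! ### Word lengths -/

section WordLength

variable {G : Type*} [Group G] {T : Set G}

theorem wordLength_one (T : Set G) : wordLength T 1 = 0 :=
  Nat.le_zero.1 (Nat.sInf_le ⟨[], by simp⟩)

theorem absLE_one_left (T : Set G) (w : G) : AbsLE T 1 w := by
  rw [AbsLE, wordLength_one, inv_one, one_mul, zero_add]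

theorem map_list_prod_le_mul_length {r : G → ℕ} {m : ℕ} (hone : r 1 = 0)
    (hmul : ∀ u v, r (u * v) ≤ r u + r v) (hT : ∀ t ∈ T, r t ≤ m) {l : List G}
    (hl : ∀ t ∈ l, t ∈ T) : r l.prod ≤ m * l.length := by
  induction l with
  | nil => rw [List.prod_nil, hone, List.length_nil, mul_zero]
  | cons t l ih =>
    have := hT t (hl t List.mem_cons_self)
    have := ih fun s hs => hl s (List.mem_cons_of_mem t hs)
    have := hmul t l.prod
    rw [List.prod_cons, List.length_cons, Nat.mul_succ]
    omega

theorem exists_list_prod_eq_of_descent {r : G → ℕ}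
    (hdesc : ∀ w, w ≠ 1 → ∃ t ∈ T, t * t = 1 ∧ r (t * w) < r w) (w : G) :
    ∃ l : List G, (∀ t ∈ l, t ∈ T) ∧ l.length ≤ r w ∧ l.prod = w := by
  induction h : r w using Nat.strong_induction_on generalizing w with
  | _ m ih =>
    subst h
    by_cases hw : w = 1
    · exact ⟨[], by simp, Nat.zero_le _, hw.symm⟩
    obtain ⟨t, ht, htt, hlt⟩ := hdesc w hw
    obtain ⟨l, hl, hlen, hprod⟩ := ih _ hlt (t * w) rfl
    refine ⟨t :: l, by simpa [ht] using hl, by simp only [List.length_cons]; omega, ?_⟩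
    rw [List.prod_cons, hprod, ← mul_assoc, htt, one_mul]

theorem wordLength_eq_of_descent {r : G → ℕ} (hone : r 1 = 0)
    (hmul : ∀ u v, r (u * v) ≤ r u + r v) (hT : ∀ t ∈ T, r t ≤ 1)
    (hdesc : ∀ w, w ≠ 1 → ∃ t ∈ T, t * t = 1 ∧ r (t * w) < r w) (w : G) :
    wordLength T w = r w := by
  obtain ⟨l, hl, hlen, rfl⟩ := exists_list_prod_eq_of_descent hdesc w
  have hle : wordLength T l.prod ≤ l.length := Nat.sInf_le ⟨l, hl, rfl, rfl⟩
  refine le_antisymm (hle.trans hlen) ?_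
  refine le_csInf ⟨_, l, hl, rfl, rfl⟩ ?_
  rintro _ ⟨l', hl', rfl, hprod⟩
  rw [← hprod, ← one_mul l'.length]
  exact map_list_prod_le_mul_length hone hmul hT hl'

end WordLength

section Transpositions

variable {X : Type*} [Finite X] [DecidableEq X]

theorem fixedCodim_swap_mul_lt {w : Equiv.Perm X} {x : X} (hx : w x ≠ x) :
    fixedCodim ⊤ (Equiv.swap x (w x) * w) < fixedCodim ⊤ w := by
  refine fixedCodim_lt (f := Pi.single x 1) ?_ trivial (single_mem_fixedSpace (by simp)) ?_
  · rintro f ⟨hf, -⟩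
    exact fixedSpace_inf_le_mul _ _ ⟨mem_fixedSpace_swap (hf x).symm, hf⟩
  · intro h
    simpa [hx] using h x

theorem wordLength_isSwap (w : Equiv.Perm X) :
    wordLength {t : Equiv.Perm X | t.IsSwap} w = fixedCodim ⊤ w := by
  refine wordLength_eq_of_descent (fixedCodim_one ⊤) (fixedCodim_mul_le ⊤) ?_ ?_ w
  · rintro t ⟨i, j, -, rfl⟩
    exact fixedCodim_le_one i j fun _ _ => mem_fixedSpace_swap
  · intro w hw
    obtain ⟨x, hx⟩ : ∃ x, w x ≠ x := by
      by_contra! h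
      exact hw (Equiv.ext h)
    exact ⟨_, ⟨x, w x, hx.symm, rfl⟩, Equiv.swap_mul_self _ _, fixedCodim_swap_mul_lt hx⟩

theorem sign_eq_neg_one_pow_fixedCodim [Fintype X] (w : Equiv.Perm X) :
    sign w = (-1) ^ fixedCodim ⊤ w := by
  have hw : w ∈ Submonoid.closure {t : Equiv.Perm X | t.IsSwap} := by
    rw [mclosure_isSwap]
    trivial
  obtain ⟨l, hl, hprod⟩ := Submonoid.exists_list_of_mem_closure hw
  have hne : {r | ∃ l : List (Equiv.Perm X),
      (∀ t ∈ l, t ∈ {t : Equiv.Perm X | t.IsSwap}) ∧ l.length = r ∧ l.prod = w}.Nonempty :=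
    ⟨_, l, hl, rfl, hprod⟩
  obtain ⟨l, hl, hlen, rfl⟩ := Nat.sInf_mem hne
  rw [sign_prod_list_swap hl, hlen, ← wordLength_isSwap, wordLength]

theorem absLE_isSwap {u v : Equiv.Perm X} :
    AbsLE {t : Equiv.Perm X | t.IsSwap} u v ↔
      fixedCodim ⊤ v = fixedCodim ⊤ u + fixedCodim ⊤ (u⁻¹ * v) := by
  simp only [AbsLE, wordLength_isSwap]

end Transpositions

/-! ### The Kreweras complement of permutations -/

section DifferenceMap

variable {X : Type*}

/-- The map `f ↦ f ∘ w - f`, whose kernel is the space of functions fixed by `w`. -/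
def differenceMap (w : Equiv.Perm X) : (X → ℚ) →ₗ[ℚ] (X → ℚ) :=
  LinearMap.funLeft ℚ ℚ w - LinearMap.id

theorem differenceMap_apply (w : Equiv.Perm X) (f : X → ℚ) (x : X) :
    differenceMap w f x = f (w x) - f x := rfl

theorem ker_differenceMap (w : Equiv.Perm X) : (differenceMap w).ker = fixedSpace w := by
  ext f
  rw [LinearMap.mem_ker, mem_fixedSpace, funext_iff]
  exact forall_congr' fun x => sub_eq_zero

theorem differenceMap_inv_mul {u v : Equiv.Perm X} {f : X → ℚ} (hf : f ∈ fixedSpace u) :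
    differenceMap (u⁻¹ * v) f = differenceMap v f := by
  ext x
  have := hf (u⁻¹ (v x))
  rw [differenceMap_apply, differenceMap_apply, mul_apply, ← this]
  simp

theorem map_differenceMap_le_range (u v : Equiv.Perm X) :
    (fixedSpace u).map (differenceMap v) ≤ (differenceMap (u⁻¹ * v)).range := by
  rintro _ ⟨f, hf, rfl⟩
  exact ⟨f, differenceMap_inv_mul hf⟩

theorem differenceMap_single [DecidableEq X] (w : Equiv.Perm X) (x : X) :
    differenceMap w (Pi.single (w x) 1) = Pi.single x 1 - Pi.single (w x) 1 := by
  ext z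
  simp [differenceMap_apply, Pi.single_apply]

theorem single_sub_single_mem_range_differenceMap [DecidableEq X] {w : Equiv.Perm X} {x y : X}
    (h : w.SameCycle x y) :
    (Pi.single x 1 - Pi.single y 1 : X → ℚ) ∈ (differenceMap w).range := by
  let P : Setoid X := Setoid.comap (fun x => (differenceMap w).range.mkQ (Pi.single x 1)) ⊥
  have hP (x y : X) :
      P x y ↔ (Pi.single x 1 - Pi.single y 1 : X → ℚ) ∈ (differenceMap w).range :=
    Submodule.Quotient.eq _
  exact (hP x y).1 (sameCycle_setoid_le_iff.2
    (fun z => (hP z (w z)).2 ⟨_, differenceMap_single w z⟩) h)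

variable [Finite X]

theorem finrank_range_differenceMap (w : Equiv.Perm X) :
    finrank ℚ (differenceMap w).range = fixedCodim ⊤ w := by
  have := Fintype.ofFinite X
  have hrank := (differenceMap w).finrank_range_add_finrank_ker
  rw [ker_differenceMap, finrank_fintype_fun_eq_card, ← Nat.card_eq_fintype_card] at hrank
  have := fixedCodim_top_add_finrank w
  omega

theorem finrank_map_differenceMap {u v : Equiv.Perm X} (h : fixedSpace v ≤ fixedSpace u) :
    finrank ℚ ((fixedSpace u).map (differenceMap v)) + fixedCodim ⊤ u = fixedCodim ⊤ v := by
  have hrank := ((differenceMap v).domRestrict (fixedSpace u)).finrank_range_add_finrank_ker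
  rw [LinearMap.range_domRestrict, LinearMap.ker_domRestrict, ker_differenceMap] at hrank
  have := (Submodule.submoduleOfEquivOfLe h).finrank_eq
  rw [Submodule.submoduleOf] at this
  have := fixedCodim_top_add_finrank u
  have := fixedCodim_top_add_finrank v
  omega

theorem sameCycle_of_differenceMap_eq [DecidableEq X] {w : Equiv.Perm X} {x y : X} {f : X → ℚ}
    (h : differenceMap w f = Pi.single x 1 - Pi.single y 1) : w.SameCycle x y := by
  have := Fintype.ofFinite X
  refine sameCycle_of_forall_fixedSpace fun g hg => ?_
  have horth : ∑ z, g z * differenceMap w f z = 0 := by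
    simp only [differenceMap_apply, mul_sub, Finset.sum_sub_distrib]
    rw [sub_eq_zero, ← Equiv.sum_comp w fun z => g z * f z]
    exact Finset.sum_congr rfl fun z _ => by rw [hg z]
  rw [h] at horth
  simpa [mul_sub, Finset.sum_sub_distrib, Pi.single_apply, sub_eq_zero] using horth

theorem range_differenceMap_le [DecidableEq X] {w : Equiv.Perm X} {S : Submodule ℚ (X → ℚ)}
    (h : ∀ x, (Pi.single x 1 - Pi.single (w x) 1 : X → ℚ) ∈ S) : (differenceMap w).range ≤ S := by
  have := Fintype.ofFinite X
  rintro _ ⟨f, rfl⟩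
  have hf : f = ∑ x, f (w x) • (Pi.single (w x) 1 : X → ℚ) := by
    rw [Equiv.sum_comp w fun x => f x • (Pi.single x 1 : X → ℚ)]
    ext z
    simp [Finset.sum_apply, Pi.single_apply]
  rw [hf, map_sum]
  refine sum_mem fun x _ => ?_
  rw [map_smul, differenceMap_single]
  exact S.smul_mem _ (h x)

theorem fixedSpace_eq_inf_of_fixedCodim_add {u v : Equiv.Perm X}
    (h : fixedCodim ⊤ v = fixedCodim ⊤ u + fixedCodim ⊤ (u⁻¹ * v)) :
    fixedSpace v = fixedSpace u ⊓ fixedSpace (u⁻¹ * v) := by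
  have := Fintype.ofFinite X
  have hsum := Submodule.finrank_sup_add_finrank_inf_eq (fixedSpace u) (fixedSpace (u⁻¹ * v))
  have hsup := Submodule.finrank_le (fixedSpace u ⊔ fixedSpace (u⁻¹ * v))
  rw [finrank_fintype_fun_eq_card, ← Nat.card_eq_fintype_card] at hsup
  have hle := fixedSpace_inf_le_mul u (u⁻¹ * v)
  rw [mul_inv_cancel_left] at hle
  have := fixedCodim_top_add_finrank u
  have := fixedCodim_top_add_finrank v
  have := fixedCodim_top_add_finrank (u⁻¹ * v)
  exact (Submodule.eq_of_le_of_finrank_le hle (by omega)).symm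

theorem map_differenceMap_eq_range {u v : Equiv.Perm X}
    (h : fixedCodim ⊤ v = fixedCodim ⊤ u + fixedCodim ⊤ (u⁻¹ * v)) :
    (fixedSpace u).map (differenceMap v) = (differenceMap (u⁻¹ * v)).range := by
  have hle : fixedSpace v ≤ fixedSpace u :=
    (fixedSpace_eq_inf_of_fixedCodim_add h).le.trans inf_le_left
  have := finrank_map_differenceMap hle
  have := finrank_range_differenceMap (u⁻¹ * v)
  exact Submodule.eq_of_le_of_finrank_le (map_differenceMap_le_range u v) (by omega)

end DifferenceMap

section RelativeKreweras

variable {X : Type*} [LinearOrder X]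

/-- The permutation `v` sends every point to the next larger one of its cycle, if there is one, and
to the least one otherwise. -/
def CyclicallyIncreasing (v : Equiv.Perm X) : Prop :=
  ∀ z, (z < v z ∧ ∀ y, v.SameCycle z y → y ≤ z ∨ v z ≤ y) ∨
    ∀ y, v.SameCycle z y → v z ≤ y ∧ y ≤ z

/-- The explicit form of the relative Kreweras complement `K^R(P)`: `x` and `y` are together iff
they are in one block `U` of `R`, and the half-open interval of `U` between them is a union of
blocks of `P`. -/
def relKrewerasAux (R P : Setoid X) : Setoid X where
  r x y := R x y ∧ ∀ a b, R x a → P a b → ((a ≤ x ↔ a ≤ y) ↔ (b ≤ x ↔ b ≤ y))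
  iseqv :=
    { refl := fun x => ⟨R.refl' x, fun _ _ _ _ => by tauto⟩
      symm := fun ⟨h, hP⟩ => ⟨R.symm' h, fun a b ha hab => by
        have := hP a b (R.trans' h ha) hab
        tauto⟩
      trans := fun ⟨h, hP⟩ ⟨h', hP'⟩ => ⟨R.trans' h h', fun a b ha hab => by
        have := hP a b ha hab
        have := hP' a b (R.trans' (R.symm' h) ha) hab
        tauto⟩ }

open Classical in
/-- The indicator function of the elements up to `y` of the cycle of `y`. Differences of these
functions are the preimages of differences of unit vectors under `differenceMap v`. -/
noncomputable def lowerIndicator (v : Equiv.Perm X) (y z : X) : ℚ :=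
  if v.SameCycle y z ∧ z ≤ y then 1 else 0

theorem differenceMap_lowerIndicator_apply {v : Equiv.Perm X} (hv : CyclicallyIncreasing v)
    {y z : X} (h : v.SameCycle y z) :
    differenceMap v (lowerIndicator v y) z =
      (if v z ≤ z then 1 else 0) - (if z = y then 1 else 0) := by
  simp only [differenceMap_apply, lowerIndicator, h, sameCycle_apply_right.2 h, true_and]
  rcases hv z with ⟨hlt, hnext⟩ | hlast
  · rw [if_neg (not_le.2 hlt)]
    rcases hnext y h.symm with hyz | hzy
    · rw [if_neg (not_le.2 (hyz.trans_lt hlt))]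
      simp only [hyz.ge_iff_eq']
    · have hzy' : z < y := hlt.trans_le hzy
      rw [if_pos hzy, if_pos hzy'.le, if_neg hzy'.ne, sub_self, sub_zero]
  · obtain ⟨hvy, hyz⟩ := hlast y h.symm
    rw [if_pos hvy, if_pos (hvy.trans hyz)]
    simp only [hyz.ge_iff_eq']

theorem differenceMap_lowerIndicator_sub {v : Equiv.Perm X} (hv : CyclicallyIncreasing v)
    {x y : X} (h : v.SameCycle x y) :
    differenceMap v (lowerIndicator v y - lowerIndicator v x) =
      Pi.single x 1 - Pi.single y 1 := by
  ext z
  rw [map_sub, Pi.sub_apply, Pi.sub_apply, Pi.single_apply, Pi.single_apply]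
  by_cases hz : v.SameCycle x z
  · rw [differenceMap_lowerIndicator_apply hv hz,
      differenceMap_lowerIndicator_apply hv (h.symm.trans hz)]
    ring
  · have hz' : ¬ v.SameCycle y z := fun h' => hz (h.trans h')
    have hx : z ≠ x := fun h' => hz (h' ▸ .refl _ _)
    have hy : z ≠ y := fun h' => hz' (h' ▸ .refl _ _)
    simp [differenceMap_apply, lowerIndicator, hz, hz', hx, hy]

theorem ite_sub_ite_eq_iff {p q p' q' : Prop} [Decidable p] [Decidable q] [Decidable p']
    [Decidable q'] (h : (p → q) ∧ (p' → q') ∨ (q → p) ∧ (q' → p')) :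
    ((if q then 1 else 0) - (if p then 1 else 0) : ℚ) =
      (if q' then 1 else 0) - (if p' then 1 else 0) ↔ ((p ↔ q) ↔ (p' ↔ q')) := by
  by_cases hp : p <;> by_cases hq : q <;> by_cases hp' : p' <;> by_cases hq' : q' <;>
    simp only [hp, hq, hp', hq', if_true, if_false] at h ⊢ <;> revert h <;> norm_num

theorem lowerIndicator_sub_apply_eq_iff {v : Equiv.Perm X} {x y a b : X}
    (hxy : v.SameCycle x y) (ha : v.SameCycle x a) (hb : v.SameCycle x b) :
    (lowerIndicator v y - lowerIndicator v x) a = (lowerIndicator v y - lowerIndicator v x) b ↔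
      ((a ≤ x ↔ a ≤ y) ↔ (b ≤ x ↔ b ≤ y)) := by
  simp only [lowerIndicator, Pi.sub_apply, ha, hb, hxy.symm.trans ha, hxy.symm.trans hb, true_and]
  convert ite_sub_ite_eq_iff ?_ using 3
  rcases le_total x y with hle | hle
  · exact .inl ⟨fun h => h.trans hle, fun h => h.trans hle⟩
  · exact .inr ⟨fun h => h.trans hle, fun h => h.trans hle⟩

theorem relKrewerasAux_sameCycle_iff {u v : Equiv.Perm X} (h : fixedSpace v ≤ fixedSpace u)
    {x y : X} :
    relKrewerasAux (SameCycle.setoid v) (SameCycle.setoid u) x y ↔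
      v.SameCycle x y ∧ lowerIndicator v y - lowerIndicator v x ∈ fixedSpace u := by
  refine and_congr_right fun hxy => ⟨fun hK z => ?_, fun hf a b ha hab => ?_⟩
  · have huz := SameCycle.refl u z |>.apply_right
    have hvz := fixedSpace_le_iff.1 h huz
    by_cases hxz : v.SameCycle x z
    · exact ((lowerIndicator_sub_apply_eq_iff hxy hxz (hxz.trans hvz)).2
        (hK z (u z) hxz huz)).symm
    · have hxuz : ¬ v.SameCycle x (u z) := fun h' => hxz (h'.trans hvz.symm)
      have hyz : ¬ v.SameCycle y z := fun h' => hxz (hxy.trans h')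
      have hyuz : ¬ v.SameCycle y (u z) := fun h' => hxuz (hxy.trans h')
      simp [lowerIndicator, *]
  · exact (lowerIndicator_sub_apply_eq_iff hxy ha (ha.trans (fixedSpace_le_iff.1 h hab))).1
      (eq_of_sameCycle hf hab)

variable [Finite X]

theorem sameCycle_setoid_inv_mul {u v : Equiv.Perm X} (hv : CyclicallyIncreasing v)
    (h : fixedCodim ⊤ v = fixedCodim ⊤ u + fixedCodim ⊤ (u⁻¹ * v)) :
    SameCycle.setoid (u⁻¹ * v) = relKrewerasAux (SameCycle.setoid v) (SameCycle.setoid u) := by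
  obtain ⟨hu, huv⟩ := le_inf_iff.1 (fixedSpace_eq_inf_of_fixedCodim_add h).le
  ext x y
  rw [relKrewerasAux_sameCycle_iff hu]
  refine ⟨fun hxy => ?_, fun ⟨hxy, hf⟩ => sameCycle_of_differenceMap_eq
    ((differenceMap_inv_mul hf).trans (differenceMap_lowerIndicator_sub hv hxy))⟩
  have hvxy : v.SameCycle x y := fixedSpace_le_iff.1 huv hxy
  refine ⟨hvxy, ?_⟩
  obtain ⟨f, hf, hfe⟩ := (map_differenceMap_eq_range h).ge
    (single_sub_single_mem_range_differenceMap hxy)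
  rw [← differenceMap_lowerIndicator_sub hv hvxy, eq_comm, ← sub_eq_zero, ← map_sub,
    ← LinearMap.mem_ker, ker_differenceMap] at hfe
  simpa only [sub_add_cancel] using add_mem (hu hfe) hf

theorem fixedCodim_add_of_sameCycle_setoid_le {u v : Equiv.Perm X} (hv : CyclicallyIncreasing v)
    (h : fixedSpace v ≤ fixedSpace u)
    (hK : SameCycle.setoid (u⁻¹ * v) ≤
      relKrewerasAux (SameCycle.setoid v) (SameCycle.setoid u)) :
    fixedCodim ⊤ v = fixedCodim ⊤ u + fixedCodim ⊤ (u⁻¹ * v) := by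
  have hrange : (differenceMap (u⁻¹ * v)).range ≤ (fixedSpace u).map (differenceMap v) :=
    range_differenceMap_le fun x => by
      obtain ⟨hx, hf⟩ := (relKrewerasAux_sameCycle_iff h).1 (sameCycle_setoid_le_iff.1 hK x)
      exact ⟨_, hf, differenceMap_lowerIndicator_sub hv hx⟩
  have hfin := Submodule.finrank_mono hrange
  rw [finrank_range_differenceMap] at hfin
  have := finrank_map_differenceMap h
  have := fixedCodim_mul_le ⊤ u (u⁻¹ * v)
  rw [mul_inv_cancel_left] at this
  omega

end RelativeKreweras

/-! ### Noncrossing partitions -/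

section Partitions

variable {X Y : Type*} [LinearOrder X] [LinearOrder Y] {P Q R : Setoid X}

theorem noncrossing_krewerasAux (P : Setoid X) : Noncrossing (krewerasAux P) :=
  fun _ _ _ _ hab hbc hcd hac hbd x y hxy =>
    four_chain (fun h => h.trans hab.le) (fun h => h.trans hbc.le) (fun h => h.trans hcd.le)
      (fun h => h.trans hab.le) (fun h => h.trans hbc.le) (fun h => h.trans hcd.le)
      (hac x y hxy) (hbd x y hxy)

theorem krewerasAux_anti (h : P ≤ Q) : krewerasAux Q ≤ krewerasAux P :=
  fun _ _ hK a b hab => hK a b (h hab)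

theorem krewerasAux_le_iff [Finite X] (hP : Noncrossing P) (hQ : Noncrossing Q) :
    krewerasAux Q ≤ krewerasAux P ↔ P ≤ Q := by
  refine ⟨fun h i j hij => ?_, krewerasAux_anti⟩
  rw [rel_iff_of_noncrossing hP] at hij
  exact (rel_iff_of_noncrossing hQ i j).2 fun u v huv => hij u v (h huv)

theorem relKrewerasAux_top (P : Setoid X) : relKrewerasAux ⊤ P = krewerasAux P :=
  Setoid.ext fun _ _ => ⟨fun h a b => h.2 a b trivial, fun h => ⟨trivial, fun a b _ => h a b⟩⟩

theorem Noncrossing.comap (hP : Noncrossing P) {f : Y → X} (hf : StrictMono f) :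
    Noncrossing (P.comap f) :=
  fun _ _ _ _ hab hbc hcd => hP _ _ _ _ (hf hab) (hf hbc) (hf hcd)

theorem relKreweras_eq_relKrewerasAux (hP : Noncrossing P) (h : P ≤ R) :
    relKreweras R P = relKrewerasAux R P := by
  have hK (U : Set X) := KDiv.kreweras_eq (hP.comap (Subtype.strictMono_coe (· ∈ U)))
  ext x y
  constructor
  · rintro ⟨_, ⟨w, rfl⟩, hx, hy, hxy⟩
    rw [hK] at hxy
    refine ⟨R.trans' hx (R.symm' hy), fun a b ha hab => ?_⟩
    have ha : R a w := R.trans' (R.symm' ha) hx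
    exact hxy ⟨a, ha⟩ ⟨b, R.trans' (R.symm' (h hab)) ha⟩ hab
  · rintro ⟨hxy, hab⟩
    refine ⟨_, ⟨x, rfl⟩, R.refl' x, R.symm' hxy, ?_⟩
    rw [hK]
    exact fun a b => hab a.1 b.1 (R.symm' a.2)

theorem Noncrossing.mem_Ioo_of_rel (hP : Noncrossing P) {j m x y : X} (hjm : P j m)
    (hgap : ∀ z ∈ Set.Ioo j m, ¬ P j z) (hxy : P x y) (hx : x ∈ Set.Ioo j m) :
    y ∈ Set.Ioo j m := by
  have hjx := hgap x hx
  have hjy : ¬ P j y := fun h => hjx (P.trans' h (P.symm' hxy))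
  refine ⟨not_le.1 fun hyj => ?_, not_le.1 fun hmy => ?_⟩
  · rcases hyj.lt_or_eq with hlt | rfl
    · exact hjy (P.symm' (hP y j x m hlt hx.1 hx.2 (P.symm' hxy) hjm))
    · exact hjy (P.refl' _)
  · rcases hmy.lt_or_eq with hlt | rfl
    · exact hjx (hP j x m y hx.1 hx.2 hlt hjm hxy)
    · exact hjy hjm

theorem Noncrossing.mem_Icc_of_rel (hP : Noncrossing P) {m j x y : X} (hmj : P m j)
    (hblock : ∀ z, P m z → z ∈ Set.Icc m j) (hxy : P x y) (hx : x ∈ Set.Icc m j) :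
    y ∈ Set.Icc m j := by
  by_cases hmx : P m x
  · exact hblock y (P.trans' hmx hxy)
  have hmy : ¬ P m y := fun h => hmx (P.trans' h (P.symm' hxy))
  have hlt : m < x := hx.1.lt_of_ne fun h => hmx (h ▸ P.refl' m)
  have hlt' : x < j := hx.2.lt_of_ne fun h => hmx (h ▸ hmj)
  refine ⟨not_lt.1 fun h => hmy ?_, not_lt.1 fun h => hmx (hP m x j y hlt hlt' h hmj hxy)⟩
  exact P.symm' (hP y m x j h hlt hlt' (P.symm' hxy) hmj)

theorem CyclicallyIncreasing.eq_of_sameCycle_setoid_eq {u v : Equiv.Perm X}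
    (hu : CyclicallyIncreasing u) (hv : CyclicallyIncreasing v)
    (h : SameCycle.setoid u = SameCycle.setoid v) : u = v := by
  ext1 z
  have huz : v.SameCycle z (u z) := h.le (SameCycle.refl u z).apply_right
  have hvz : u.SameCycle z (v z) := h.ge (SameCycle.refl v z).apply_right
  rcases hu z with ⟨hlt, hnext⟩ | hlast <;> rcases hv z with ⟨hlt', hnext'⟩ | hlast'
  · exact ((hnext _ hvz).resolve_left (not_le.2 hlt')).antisymm
      ((hnext' _ huz).resolve_left (not_le.2 hlt))
  · exact absurd (hlast' _ huz).2 (not_le.2 hlt)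
  · exact absurd (hlast _ hvz).2 (not_le.2 hlt')
  · exact (hlast _ hvz).1.antisymm (hlast' _ huz).1

end Partitions

/-! ### The permutations below the long cycle -/

section LongCycle

variable {N : ℕ}

theorem cyc_val (x : Fin N) : (cyc N x : ℕ) = (x + 1) % N := by
  cases N with
  | zero => exact x.elim0
  | succ n => rw [cyc, finRotate_apply, Fin.val_add, Fin.val_one', Nat.add_mod_mod]

theorem cyc_pow_val (m : ℕ) (x : Fin N) : ((cyc N ^ m) x : ℕ) = (x + m) % N := by
  induction m with
  | zero => simp [Nat.mod_eq_of_lt x.2]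
  | succ m ih => rw [pow_succ', mul_apply, cyc_val, ih, Nat.mod_add_mod, add_assoc]

theorem cyc_val_eq_or (z : Fin N) :
    ((cyc N z : ℕ) = z + 1) ∨ ((cyc N z : ℕ) = 0 ∧ (z : ℕ) + 1 = N) := by
  rcases Nat.lt_or_ge (z + 1) N with h | h
  · exact .inl (by rw [cyc_val, Nat.mod_eq_of_lt h])
  · have hz : (z : ℕ) + 1 = N := le_antisymm z.2 h
    exact .inr ⟨by rw [cyc_val, hz, Nat.mod_self], hz⟩

theorem sameCycle_cyc (x y : Fin N) : (cyc N).SameCycle x y := by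
  refine ⟨((N - x + y : ℕ) : ℤ), Fin.ext ?_⟩
  rw [zpow_natCast, cyc_pow_val, ← add_assoc, Nat.add_sub_cancel' x.2.le, Nat.add_mod_left,
    Nat.mod_eq_of_lt y.2]

theorem orbitPartition_cyc : orbitPartition (cyc N) = ⊤ :=
  eq_top_iff.2 fun x y _ => sameCycle_cyc x y

theorem cyclicallyIncreasing_cyc : CyclicallyIncreasing (cyc N) := by
  intro z
  simp only [Fin.lt_def, Fin.le_def]
  rcases cyc_val_eq_or z with hz | hz
  · exact .inl ⟨by omega, fun y _ => by omega⟩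
  · exact .inr fun y _ => by omega

theorem orbitPartition_le_iff {u v : Equiv.Perm (Fin N)} :
    orbitPartition u ≤ orbitPartition v ↔ fixedSpace v ≤ fixedSpace u :=
  fixedSpace_le_iff.symm

theorem fixedSpace_cyc_le (u : Equiv.Perm (Fin N)) : fixedSpace (cyc N) ≤ fixedSpace u := by
  rw [← orbitPartition_le_iff, orbitPartition_cyc]
  exact le_top

theorem fixedCodim_cyc (N : ℕ) : fixedCodim ⊤ (cyc N) = N - 1 := by
  have hcard := fixedCodim_top_add_finrank (cyc N)
  rw [Nat.card_fin] at hcard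
  rcases N.eq_zero_or_pos with rfl | hN
  · omega
  have hspan : fixedSpace (cyc N) = Submodule.span ℚ {(1 : Fin N → ℚ)} := by
    ext f
    rw [Submodule.mem_span_singleton]
    constructor
    · intro hf
      exact ⟨f ⟨0, hN⟩, funext fun x => by
        simpa using eq_of_sameCycle hf (sameCycle_cyc ⟨0, hN⟩ x)⟩
    · rintro ⟨a, rfl⟩ x
      simp
  have hne : (1 : Fin N → ℚ) ≠ 0 := fun h => one_ne_zero (congrFun h ⟨0, hN⟩)
  rw [hspan, finrank_span_singleton hne] at hcard
  omega

theorem orbitPartition_conj (g u : Equiv.Perm (Fin N)) (x y : Fin N) :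
    orbitPartition (g * u * g⁻¹) (g x) (g y) ↔ orbitPartition u x y := by
  change (g * u * g⁻¹).SameCycle _ _ ↔ u.SameCycle _ _
  rw [sameCycle_conj, coe_inv, Equiv.symm_apply_apply, Equiv.symm_apply_apply]

theorem absLE_reflA {u v : Equiv.Perm (Fin N)} :
    AbsLE (reflA N) u v ↔ fixedCodim ⊤ v = fixedCodim ⊤ u + fixedCodim ⊤ (u⁻¹ * v) :=
  absLE_isSwap

theorem absLE_reflA_trans {u v w : Equiv.Perm (Fin N)} (huv : AbsLE (reflA N) u v)
    (hvw : AbsLE (reflA N) v w) : AbsLE (reflA N) u w := by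
  rw [absLE_reflA] at *
  have huw := fixedCodim_mul_le ⊤ u (u⁻¹ * w)
  have hmul := fixedCodim_mul_le ⊤ (u⁻¹ * v) (v⁻¹ * w)
  rw [mul_inv_cancel_left] at huw
  rw [mul_assoc, mul_inv_cancel_left] at hmul
  omega

theorem orbitPartition_le_of_absLE {u v : Equiv.Perm (Fin N)} (h : AbsLE (reflA N) u v) :
    orbitPartition u ≤ orbitPartition v :=
  orbitPartition_le_iff.2
    ((fixedSpace_eq_inf_of_fixedCodim_add (absLE_reflA.1 h)).le.trans inf_le_left)

/-- The permutations below the long cycle in the absolute order. They are determined by their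
orbit partitions, which are the noncrossing partitions. -/
def BelowCyc (u : Equiv.Perm (Fin N)) : Prop :=
  AbsLE (reflA N) u (cyc N)

namespace BelowCyc

variable {u v : Equiv.Perm (Fin N)}

theorem inv_mul_cyc (h : BelowCyc u) : BelowCyc (u⁻¹ * cyc N) := by
  have hconj : (u⁻¹ * cyc N)⁻¹ * cyc N = (cyc N)⁻¹ * u * (cyc N)⁻¹⁻¹ := by group
  rw [BelowCyc, absLE_reflA, hconj, fixedCodim_conj, add_comm]
  exact absLE_reflA.1 h

theorem cyc_mul_inv (h : BelowCyc u) : BelowCyc (cyc N * u⁻¹) := by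
  have hinv : (cyc N * u⁻¹)⁻¹ * cyc N = u := by group
  have hconj : cyc N * u⁻¹ = cyc N * (u⁻¹ * cyc N) * (cyc N)⁻¹ := by group
  rw [BelowCyc, absLE_reflA, hinv, hconj, fixedCodim_conj, add_comm]
  exact absLE_reflA.1 h

theorem conj {g : Equiv.Perm (Fin N)} (hg : Commute g (cyc N)) (h : BelowCyc u) :
    BelowCyc (g * u * g⁻¹) := by
  have hcyc : (g * u * g⁻¹)⁻¹ * cyc N = g * (u⁻¹ * cyc N) * g⁻¹ := by
    rw [mul_inv_rev, mul_inv_rev, inv_inv, mul_assoc, mul_assoc, hg.inv_left.eq]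
    group
  rw [BelowCyc, absLE_reflA, hcyc, fixedCodim_conj, fixedCodim_conj]
  exact absLE_reflA.1 h

theorem krewerasAux_eq (h : BelowCyc u) :
    krewerasAux (orbitPartition u) = orbitPartition (u⁻¹ * cyc N) := by
  rw [← relKrewerasAux_top, ← orbitPartition_cyc]
  exact (sameCycle_setoid_inv_mul cyclicallyIncreasing_cyc (absLE_reflA.1 h)).symm

end BelowCyc

theorem belowCyc_of_orbitPartition_le {u : Equiv.Perm (Fin N)}
    (h : orbitPartition (u⁻¹ * cyc N) ≤ krewerasAux (orbitPartition u)) : BelowCyc u := by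
  rw [← relKrewerasAux_top, ← orbitPartition_cyc] at h
  exact absLE_reflA.2
    (fixedCodim_add_of_sameCycle_setoid_le cyclicallyIncreasing_cyc (fixedSpace_cyc_le u) h)

namespace BelowCyc

variable {u v : Equiv.Perm (Fin N)}

theorem noncrossing (h : BelowCyc u) : Noncrossing (orbitPartition u) := by
  have hK := h.cyc_mul_inv.krewerasAux_eq
  have hinv : (cyc N * u⁻¹)⁻¹ * cyc N = u := by group
  rw [hinv] at hK
  exact hK ▸ noncrossing_krewerasAux _

theorem exists_krewerasAux (h : BelowCyc u) (j : Fin N) :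
    ∃ i, cyc N i = u j ∧ krewerasAux (orbitPartition u) i j := by
  refine ⟨(cyc N)⁻¹ (u j), Equiv.apply_symm_apply _ _, ?_⟩
  rw [h.krewerasAux_eq]
  change (u⁻¹ * cyc N).SameCycle _ _
  simpa using (SameCycle.refl (u⁻¹ * cyc N) ((cyc N)⁻¹ (u j))).apply_right

theorem cyclicallyIncreasing (hu : BelowCyc u) : CyclicallyIncreasing u := by
  intro j
  obtain ⟨i, hi, hij⟩ := hu.exists_krewerasAux j
  have huj := hij _ _ (SameCycle.refl u j).apply_right
  rw [← hi] at huj ⊢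
  have hcyc := cyc_val_eq_or i
  simp only [Fin.le_def, Fin.lt_def] at huj ⊢
  have hK (y : Fin N) (hy : u.SameCycle j y) :
      (((j : ℕ) ≤ i ↔ (j : ℕ) ≤ j) ↔ ((y : ℕ) ≤ i ↔ (y : ℕ) ≤ j)) := hij j y hy
  by_cases hlt : (j : ℕ) < cyc N i
  · exact .inl ⟨hlt, fun y hy => by have := hK y hy; omega⟩
  · exact .inr fun y hy => by have := hK y hy; omega

theorem eq_of_orbitPartition_eq (hu : BelowCyc u) (hv : BelowCyc v)
    (h : orbitPartition u = orbitPartition v) : u = v :=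
  hu.cyclicallyIncreasing.eq_of_sameCycle_setoid_eq hv.cyclicallyIncreasing h

theorem commute_iff {g : Equiv.Perm (Fin N)} (hg : Commute g (cyc N)) (h : BelowCyc u) :
    Commute g u ↔ ∀ x y, orbitPartition u (g x) (g y) ↔ orbitPartition u x y := by
  refine ⟨fun hc x y => ?_, fun hs => ?_⟩
  · rw [← orbitPartition_conj g u x y, hc.mul_inv_cancel]
  · refine mul_inv_eq_iff_eq_mul.1 ((h.conj hg).eq_of_orbitPartition_eq h ?_)
    ext x y
    obtain ⟨x, rfl⟩ := g.surjective x
    obtain ⟨y, rfl⟩ := g.surjective y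
    rw [orbitPartition_conj, hs]

theorem absLE_iff_orbitPartition_le (hu : BelowCyc u) (hv : BelowCyc v) :
    AbsLE (reflA N) u v ↔ orbitPartition u ≤ orbitPartition v := by
  refine ⟨orbitPartition_le_of_absLE, fun hle => absLE_reflA.2 ?_⟩
  refine fixedCodim_add_of_sameCycle_setoid_le hv.cyclicallyIncreasing
    (orbitPartition_le_iff.1 hle) (sameCycle_setoid_le_iff.2 fun x => ?_)
  have hux : u.SameCycle ((u⁻¹ * v) x) (v x) := by
    simpa using (SameCycle.refl u ((u⁻¹ * v) x)).apply_right
  refine ⟨(SameCycle.refl v x).apply_right.trans (hle hux).symm, fun a b ha hab => ?_⟩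
  obtain ⟨i, hi, hiK⟩ := hu.exists_krewerasAux ((u⁻¹ * v) x)
  have hK := hiK a b hab
  have hb : v.SameCycle x b := SameCycle.trans ha (hle hab)
  have hcyc := cyc_val_eq_or i
  rw [hi, show u ((u⁻¹ * v) x) = v x from u.apply_symm_apply _] at hcyc
  have hvx := hv.cyclicallyIncreasing x
  simp only [Fin.le_def, Fin.lt_def] at hK hvx ⊢
  rcases hvx with ⟨hlt, hnext⟩ | hlast
  · have := hnext a ha
    have := hnext b hb
    omega
  · have := hlast a ha
    have := hlast b hb
    omega

theorem kreweras_eq (h : BelowCyc u) :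
    kreweras (orbitPartition u) = orbitPartition (u⁻¹ * cyc N) := by
  rw [KDiv.kreweras_eq h.noncrossing, h.krewerasAux_eq]

theorem krewerasInv_eq (h : BelowCyc u) :
    krewerasInv (orbitPartition (u⁻¹ * cyc N)) = orbitPartition u := by
  rw [← h.kreweras_eq]
  exact kreweras_injOn.leftInvOn_invFunOn h.noncrossing

theorem relKreweras_eq (hv : BelowCyc v) (h : AbsLE (reflA N) u v) :
    relKreweras (orbitPartition v) (orbitPartition u) = orbitPartition (u⁻¹ * v) := by
  have hu : BelowCyc u := absLE_reflA_trans h hv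
  rw [relKreweras_eq_relKrewerasAux hu.noncrossing (orbitPartition_le_of_absLE h)]
  exact (sameCycle_setoid_inv_mul hv.cyclicallyIncreasing (absLE_reflA.1 h)).symm

end BelowCyc

theorem Noncrossing.exists_krewerasAux {P : Setoid (Fin N)} (hP : Noncrossing P) (j : Fin N) :
    ∃ i, P j (cyc N i) ∧ krewerasAux P i j := by
  suffices h : ∃ m, P j m ∧ krewerasAux P ((cyc N)⁻¹ m) j by
    obtain ⟨m, hjm, hK⟩ := h
    exact ⟨_, by rwa [coe_inv, Equiv.apply_symm_apply], hK⟩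
  by_cases hex : ∃ x, P j x ∧ j < x
  · obtain ⟨m, ⟨hjm, hlt⟩, hmin⟩ :=
      Set.exists_min_image {x | P j x ∧ j < x} id (Set.toFinite _) hex
    have hgap : ∀ z ∈ Set.Ioo j m, ¬ P j z := fun z hz h => (hmin z ⟨h, hz.1⟩).not_gt hz.2
    refine ⟨m, hjm, fun a b hab => ?_⟩
    have hcyc := cyc_val_eq_or ((cyc N)⁻¹ m)
    have ha := hP.mem_Ioo_of_rel hjm hgap hab
    have hb := hP.mem_Ioo_of_rel hjm hgap (P.symm' hab)
    rw [show cyc N ((cyc N)⁻¹ m) = m from (cyc N).apply_symm_apply m] at hcyc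
    simp only [Set.mem_Ioo, Fin.le_def, Fin.lt_def] at ha hb hlt ⊢
    omega
  · obtain ⟨m, hjm, hmin⟩ := Set.exists_min_image {x | P j x} id (Set.toFinite _) ⟨j, P.refl' j⟩
    have hblock (z : Fin N) (hz : P m z) : z ∈ Set.Icc m j :=
      ⟨hmin z (P.trans' hjm hz), not_lt.1 fun h => hex ⟨z, P.trans' hjm hz, h⟩⟩
    have hmj := (hblock j (P.symm' hjm)).1
    refine ⟨m, hjm, fun a b hab => ?_⟩
    have hcyc := cyc_val_eq_or ((cyc N)⁻¹ m)
    have ha := hP.mem_Icc_of_rel (P.symm' hjm) hblock hab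
    have hb := hP.mem_Icc_of_rel (P.symm' hjm) hblock (P.symm' hab)
    rw [show cyc N ((cyc N)⁻¹ m) = m from (cyc N).apply_symm_apply m] at hcyc
    simp only [Set.mem_Icc, Fin.le_def] at ha hb hmj ⊢
    omega

theorem Noncrossing.exists_belowCyc {P : Setoid (Fin N)} (hP : Noncrossing P) :
    ∃ u : Equiv.Perm (Fin N), BelowCyc u ∧ orbitPartition u = P := by
  choose p hp hpK using hP.exists_krewerasAux
  have hinj : Function.Injective fun j => cyc N (p j) := fun j j' h => by
    have hpj : p j = p j' := (cyc N).injective h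
    have hK : krewerasAux P j j' := Setoid.trans' _ (Setoid.symm' _ (hpK j)) (hpj ▸ hpK j')
    have hle := hK j j' (P.trans' (hp j) (hpj ▸ P.symm' (hp j')))
    simp only [le_refl, true_iff, iff_true] at hle
    exact (le_total j j').elim (fun h => h.antisymm (hle.1 h)) fun h => (hle.2 h).antisymm h
  let u : Equiv.Perm (Fin N) := Equiv.ofBijective _ (Finite.injective_iff_bijective.1 hinj)
  have hle : orbitPartition u ≤ P := sameCycle_setoid_le_iff.2 hp
  have hKle : orbitPartition (u⁻¹ * cyc N) ≤ krewerasAux P := by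
    refine sameCycle_setoid_le_iff.2 fun x => ?_
    have hx : cyc N (p ((u⁻¹ * cyc N) x)) = cyc N x := u.apply_symm_apply (cyc N x)
    have hstep := hpK ((u⁻¹ * cyc N) x)
    rwa [(cyc N).injective hx] at hstep
  have hbelow : BelowCyc u := belowCyc_of_orbitPartition_le (hKle.trans (krewerasAux_anti hle))
  refine ⟨u, hbelow, hle.antisymm ?_⟩
  rwa [← krewerasAux_le_iff hP hbelow.noncrossing, hbelow.krewerasAux_eq]

end LongCycle

/-! ### Sequences and their successive quotients -/

section Extension

variable {α : Type*} {k : ℕ}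

/-- The infinite sequence `π₁, …, π_k, c, c, …`. -/
def extendBy (c : α) (π : Fin k → α) (i : ℕ) : α :=
  if h : i < k then π ⟨i, h⟩ else c

theorem extendBy_val (c : α) (π : Fin k → α) (i : Fin k) : extendBy c π i = π i :=
  dif_pos i.2

theorem extendBy_self (c : α) (π : Fin k → α) : extendBy c π k = c :=
  dif_neg (lt_irrefl k)

end Extension

section Sequences

variable {G : Type*} [Group G]

theorem length_inv_mul_le_sum {r : G → ℕ} (hone : r 1 = 0)
    (hmul : ∀ u v, r (u * v) ≤ r u + r v) (p : ℕ → G) {a b : ℕ} (hab : a ≤ b) :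
    r ((p a)⁻¹ * p b) ≤ ∑ i ∈ Finset.Ico a b, r ((p i)⁻¹ * p (i + 1)) := by
  induction b, hab using Nat.le_induction with
  | base => simp [hone]
  | succ b hab ih =>
    have := hmul ((p a)⁻¹ * p b) ((p b)⁻¹ * p (b + 1))
    rw [mul_assoc, mul_inv_cancel_left] at this
    rw [Finset.sum_Ico_succ_top hab]
    omega

theorem length_eq_add_of_length_eq_add_sum {r : G → ℕ} (hone : r 1 = 0)
    (hmul : ∀ u v, r (u * v) ≤ r u + r v) {p : ℕ → G} {k : ℕ}
    (h : r (p k) = r (p 0) + ∑ i ∈ Finset.range k, r ((p i)⁻¹ * p (i + 1))) {a b : ℕ}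
    (hab : a ≤ b) (hb : b ≤ k) : r (p b) = r (p a) + r ((p a)⁻¹ * p b) := by
  have hsum {a b : ℕ} (hab : a ≤ b) := length_inv_mul_le_sum hone hmul p hab
  have htriangle (a b : ℕ) : r (p b) ≤ r (p a) + r ((p a)⁻¹ * p b) := by
    simpa using hmul (p a) ((p a)⁻¹ * p b)
  have := htriangle 0 a
  have := htriangle a b
  have := htriangle b k
  have := hsum a.zero_le
  have := hsum hab
  have := hsum hb
  have := Finset.sum_Ico_consecutive (fun i => r ((p i)⁻¹ * p (i + 1))) a.zero_le hab
  have := Finset.sum_Ico_consecutive (fun i => r ((p i)⁻¹ * p (i + 1))) b.zero_le hb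
  rw [Finset.range_eq_Ico] at h
  omega

variable {k : ℕ} {c : G}

/-- The sequence `π₁⁻¹ π₂, …, π_{k-1}⁻¹ π_k, π_k⁻¹ c`, which is the delta sequence if `π` is a
multichain. -/
def quotientSeq (c : G) (π : Fin k → G) (i : Fin k) : G :=
  (π i)⁻¹ * extendBy c π (i + 1)

theorem quotientSeq_eq (c : G) (π : Fin k → G) (i : Fin k) :
    quotientSeq c π i = (extendBy c π i)⁻¹ * extendBy c π (i + 1) := by
  rw [extendBy_val]
  rfl

theorem quotientSeq_injective : Function.Injective (quotientSeq (k := k) c) := by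
  intro π μ h
  have hextend (m : ℕ) (hm : m ≤ k) : extendBy c π m = extendBy c μ m := by
    induction hm using Nat.decreasingInduction with
    | self => rw [extendBy_self, extendBy_self]
    | of_succ m hm ih =>
      have hm' := congrFun h ⟨m, hm⟩
      rw [quotientSeq_eq, quotientSeq_eq, ih] at hm'
      exact inv_injective (mul_right_cancel hm')
  funext i
  rw [← extendBy_val c π, ← extendBy_val c μ, hextend i i.2.le]

theorem quotientSeq_surjective [Finite G] : Function.Surjective (quotientSeq (k := k) c) :=
  Finite.surjective_of_injective quotientSeq_injective

theorem quotientSeq_mem_iff {H : Subgroup G} (hc : c ∈ H) {π : Fin k → G} :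
    (∀ i, quotientSeq c π i ∈ H) ↔ ∀ i, π i ∈ H := by
  constructor
  · intro h
    have hextend (m : ℕ) (hm : m ≤ k) : extendBy c π m ∈ H := by
      induction hm using Nat.decreasingInduction with
      | self => rwa [extendBy_self]
      | of_succ m hm ih =>
        have hm' := h ⟨m, hm⟩
        rwa [quotientSeq_eq, H.mul_mem_cancel_right ih, inv_mem_iff] at hm'
    exact fun i => extendBy_val c π i ▸ hextend i i.2.le
  · intro h i
    refine H.mul_mem (H.inv_mem (h i)) ?_
    rw [extendBy]
    split_ifs
    exacts [h _, hc]

end Sequences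

/-! ### Shuffles of permutations -/

section Shuffle

theorem finrank_fixedSpace_sigmaCongrRight {ι : Type*} [Fintype ι] {X : ι → Type*}
    [∀ i, Finite (X i)] (δ : ∀ i, Equiv.Perm (X i)) :
    finrank ℚ (fixedSpace (sigmaCongrRight δ)) = ∑ i, finrank ℚ (fixedSpace (δ i)) := by
  let e : fixedSpace (sigmaCongrRight δ) ≃ₗ[ℚ] (∀ i, fixedSpace (δ i)) :=
    { toFun := fun f i => ⟨fun x => f.1 ⟨i, x⟩, fun x => f.2 ⟨i, x⟩⟩
      invFun := fun g => ⟨fun p => (g p.1).1 p.2, fun p => (g p.1).2 p.2⟩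
      map_add' := fun _ _ => rfl
      map_smul' := fun _ _ => rfl
      left_inv := fun _ => rfl
      right_inv := fun _ => rfl }
  rw [e.finrank_eq, finrank_pi_fintype]

theorem fixedCodim_sigmaCongrRight {ι : Type*} [Fintype ι] {X : ι → Type*} [∀ i, Finite (X i)]
    (δ : ∀ i, Equiv.Perm (X i)) :
    fixedCodim ⊤ (sigmaCongrRight δ) = ∑ i, fixedCodim ⊤ (δ i) := by
  have htotal := fixedCodim_top_add_finrank (sigmaCongrRight δ)
  rw [finrank_fixedSpace_sigmaCongrRight, Nat.card_sigma,
    Finset.sum_congr rfl fun i _ => (fixedCodim_top_add_finrank (δ i)).symm,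
    Finset.sum_add_distrib] at htotal
  exact Nat.add_right_cancel htotal

theorem finrank_fixedSpace_spiral {X : Type*} {k : ℕ}
    {w : Equiv.Perm (X × Fin (k + 1))} {u : Equiv.Perm X}
    (hsucc : ∀ x (i : Fin k), w (x, i.castSucc) = (x, i.succ))
    (hlast : ∀ x, w (x, Fin.last k) = (u x, 0)) :
    finrank ℚ (fixedSpace w) = finrank ℚ (fixedSpace u) := by
  have hmap : fixedSpace w = (fixedSpace u).map (LinearMap.funLeft ℚ ℚ Prod.fst) := by
    ext f
    constructor
    · intro hf
      have hconst (x : X) (i : Fin (k + 1)) : f (x, i) = f (x, 0) := by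
        induction i using Fin.induction with
        | zero => rfl
        | succ i ih => rw [← hsucc, hf, ih]
      refine ⟨fun x => f (x, 0), fun x => ?_, funext fun p => (hconst p.1 p.2).symm⟩
      change f (u x, 0) = f (x, 0)
      rw [← hlast, hf, hconst]
    · rintro ⟨g, hg, rfl⟩ ⟨x, i⟩
      change g (w (x, i)).1 = g x
      induction i using Fin.lastCases with
      | last => rw [hlast, hg]
      | cast i => rw [hsucc]
  rw [hmap]
  exact (Submodule.equivMapOfInjective _
    (LinearMap.funLeft_injective_of_surjective _ _ _ Prod.fst_surjective) _).finrank_eq.symm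

variable {N k : ℕ}

/-- The point `kj - (k - i)` of `[Nk]`, for `j` in `[N]` and `i` in `[k]`: the `i`-th copy of `j`
in the shuffle of `k` copies of `[N]`. -/
def copyEquiv (N k : ℕ) : (Σ _ : Fin k, Fin N) ≃ Fin (N * k) :=
  (Equiv.sigmaEquivProd _ _).trans ((Equiv.prodComm _ _).trans finProdFinEquiv)

/-- The permutation of `[Nk]` that acts as `δ i` on the `i`-th of `k` interleaved copies of
`[N]`. -/
def shufflePerm (N k : ℕ) : (Fin k → Equiv.Perm (Fin N)) →* Equiv.Perm (Fin (N * k)) :=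
  (copyEquiv N k).permCongrHom.toMonoidHom.comp (sigmaCongrRightHom _)

theorem shufflePerm_eq (δ : Fin k → Equiv.Perm (Fin N)) :
    shufflePerm N k δ = (copyEquiv N k).permCongr (sigmaCongrRight δ) := rfl

theorem shufflePerm_apply (δ : Fin k → Equiv.Perm (Fin N)) (j : Fin N) (i : Fin k) :
    shufflePerm N k δ (finProdFinEquiv (j, i)) = finProdFinEquiv (δ i j, i) := by
  change copyEquiv N k (sigmaCongrRight δ ((copyEquiv N k).symm (copyEquiv N k ⟨i, j⟩))) = _
  rw [Equiv.symm_apply_apply]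
  rfl

theorem shufflePerm_injective : Function.Injective (shufflePerm N k) :=
  (copyEquiv N k).permCongrHom.injective.comp sigmaCongrRightHom_injective

theorem fixedCodim_shufflePerm (δ : Fin k → Equiv.Perm (Fin N)) :
    fixedCodim ⊤ (shufflePerm N k δ) = ∑ i, fixedCodim ⊤ (δ i) := by
  rw [shufflePerm_eq, fixedCodim_permCongr, fixedCodim_sigmaCongrRight]

theorem commute_shufflePerm_iff {δ : Fin k → Equiv.Perm (Fin N)} {g : Equiv.Perm (Fin N)} :
    Commute (shufflePerm N k fun _ => g) (shufflePerm N k δ) ↔ ∀ i, Commute g (δ i) := by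
  simp only [commute_iff_eq, ← map_mul, shufflePerm_injective.eq_iff, funext_iff, Pi.mul_apply]

theorem shuffleFin_apply {Q : Fin k → Setoid (Fin N)} {j j' : Fin N} {i i' : Fin k} :
    shuffleFin Q (finProdFinEquiv (j, i)) (finProdFinEquiv (j', i')) ↔ i = i' ∧ Q i j j' := by
  have hsymm (p : Fin N × Fin k) :
      ((finProdFinEquiv p).divNat, (finProdFinEquiv p).modNat) = p :=
    finProdFinEquiv.symm_apply_apply p
  rw [shuffleFin, Setoid.comap_rel, hsymm, hsymm]
  rfl

theorem orbitPartition_shufflePerm (δ : Fin k → Equiv.Perm (Fin N)) :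
    orbitPartition (shufflePerm N k δ) = shuffleFin fun i => orbitPartition (δ i) := by
  ext x y
  obtain ⟨⟨j, i⟩, rfl⟩ := finProdFinEquiv.surjective x
  obtain ⟨⟨j', i'⟩, rfl⟩ := finProdFinEquiv.surjective y
  have hpow (z : ℤ) : (shufflePerm N k δ ^ z) (finProdFinEquiv (j, i)) =
      finProdFinEquiv ((δ i ^ z) j, i) := by
    rw [← map_zpow, shufflePerm_apply, Pi.pow_apply]
  rw [shuffleFin_apply]
  change (∃ z : ℤ, _) ↔ _
  simp only [hpow, EmbeddingLike.apply_eq_iff_eq, Prod.mk.injEq]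
  exact ⟨fun ⟨z, h, h'⟩ => ⟨h', z, h⟩, fun ⟨h', z, h⟩ => ⟨z, h, h'⟩⟩

theorem cyc_finProdFinEquiv_castSucc (j : Fin N) (i : Fin k) :
    cyc (N * (k + 1)) (finProdFinEquiv (j, i.castSucc)) = finProdFinEquiv (j, i.succ) := by
  have hlt := (finProdFinEquiv (j, i.succ)).2
  apply Fin.ext
  rw [cyc_val]
  simp only [finProdFinEquiv_apply_val, Fin.val_castSucc, Fin.val_succ] at hlt ⊢
  rw [Nat.mod_eq_of_lt (by omega)]
  omega

theorem cyc_finProdFinEquiv_last (j : Fin N) :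
    cyc (N * (k + 1)) (finProdFinEquiv (j, Fin.last k)) = finProdFinEquiv (cyc N j, 0) := by
  apply Fin.ext
  simp only [cyc_val, finProdFinEquiv_apply_val, Fin.val_last, Fin.val_zero, zero_add]
  rw [← Nat.mul_mod_mul_left, mul_comm N]
  congr 1
  ring

theorem cyc_pow_mul (m : ℕ) : cyc (N * k) ^ (k * m) = shufflePerm N k fun _ => cyc N ^ m := by
  ext1 x
  obtain ⟨⟨j, i⟩, rfl⟩ := finProdFinEquiv.surjective x
  rw [shufflePerm_apply]
  apply Fin.ext
  simp only [cyc_pow_val, finProdFinEquiv_apply_val]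
  have hk : 0 < k := i.pos
  rw [add_assoc, ← mul_add, mul_comm N k, Nat.mod_mul, Nat.add_mul_mod_self_left,
    Nat.mod_eq_of_lt i.2, Nat.add_mul_div_left _ _ hk, Nat.div_eq_of_lt i.2, zero_add]

end Shuffle

/-! ### Multichains and the permutations of the shuffled points -/

section Nabla

variable {N k : ℕ}

/-- The permutation of `[Nk]` whose orbit partition is the image of the multichain `π` under the
type `A` map. -/
def nablaPerm (π : Fin k → Equiv.Perm (Fin N)) : Equiv.Perm (Fin (N * k)) :=
  cyc (N * k) * (shufflePerm N k (quotientSeq (cyc N) π))⁻¹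

theorem nablaPerm_inv_mul_cyc (π : Fin k → Equiv.Perm (Fin N)) :
    (nablaPerm π)⁻¹ * cyc (N * k) = shufflePerm N k (quotientSeq (cyc N) π) := by
  rw [nablaPerm]
  group

theorem finrank_fixedSpace_shufflePerm_mul_cyc_mul {δ ε : Fin (k + 1) → Equiv.Perm (Fin N)}
    (h : ∀ i : Fin k, δ i.succ * ε i.castSucc = 1) :
    finrank ℚ (fixedSpace
      (shufflePerm N (k + 1) δ * cyc (N * (k + 1)) * shufflePerm N (k + 1) ε)) =
        finrank ℚ (fixedSpace (δ 0 * cyc N * ε (Fin.last k))) := by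
  rw [← finrank_fixedSpace_permCongr finProdFinEquiv.symm]
  refine finrank_fixedSpace_spiral (fun j i => ?_) fun j => ?_
  · rw [Equiv.permCongr_apply, Equiv.symm_symm, mul_apply, shufflePerm_apply, mul_apply,
      cyc_finProdFinEquiv_castSucc, shufflePerm_apply, ← mul_apply, h, one_apply,
      Equiv.symm_apply_apply]
  · rw [Equiv.permCongr_apply, Equiv.symm_symm, mul_apply, shufflePerm_apply, mul_apply,
      cyc_finProdFinEquiv_last, shufflePerm_apply, Equiv.symm_apply_apply]
    rfl

theorem finrank_fixedSpace_nablaPerm (π : Fin (k + 1) → Equiv.Perm (Fin N)) :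
    finrank ℚ (fixedSpace (nablaPerm π)) = finrank ℚ (fixedSpace (π 0)) := by
  let next (i : Fin (k + 1)) : Equiv.Perm (Fin N) := extendBy (cyc N) π (i + 1)
  have hconj : shufflePerm N (k + 1) π * nablaPerm π * (shufflePerm N (k + 1) π)⁻¹ =
      shufflePerm N (k + 1) π * cyc (N * (k + 1)) * shufflePerm N (k + 1) next⁻¹ := by
    have hquotient : quotientSeq (cyc N) π = π⁻¹ * next := rfl
    rw [nablaPerm, hquotient, map_mul, map_inv, map_inv, mul_inv_rev, inv_inv]
    simp only [mul_assoc, mul_inv_cancel, mul_one]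
  have hrank : finrank ℚ (fixedSpace (nablaPerm π)) = finrank ℚ (fixedSpace
      (shufflePerm N (k + 1) π * nablaPerm π * (shufflePerm N (k + 1) π)⁻¹)) :=
    (finrank_fixedSpace_permCongr (shufflePerm N (k + 1) π) _).symm
  have hsucc (i : Fin k) : next i.castSucc = π i.succ := extendBy_val (cyc N) π i.succ
  have hlast : next (Fin.last k) = cyc N := extendBy_self (cyc N) π
  rw [hrank, hconj, finrank_fixedSpace_shufflePerm_mul_cyc_mul fun i => by
    rw [Pi.inv_apply, hsucc, mul_inv_cancel], Pi.inv_apply, hlast, mul_inv_cancel_right]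

theorem sum_fixedCodim_quotientSeq (c : Equiv.Perm (Fin N)) (π : Fin k → Equiv.Perm (Fin N)) :
    ∑ i, fixedCodim ⊤ (quotientSeq c π i) =
      ∑ i ∈ Finset.range k, fixedCodim ⊤ ((extendBy c π i)⁻¹ * extendBy c π (i + 1)) := by
  simp only [quotientSeq_eq]
  exact Fin.sum_univ_eq_sum_range
    (fun i => fixedCodim ⊤ ((extendBy c π i)⁻¹ * extendBy c π (i + 1))) k

theorem belowCyc_nablaPerm_iff {π : Fin (k + 1) → Equiv.Perm (Fin N)} {p : ℕ → Equiv.Perm (Fin N)}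
    (hp : p = extendBy (cyc N) π) :
    BelowCyc (nablaPerm π) ↔ fixedCodim ⊤ (p (k + 1)) =
      fixedCodim ⊤ (p 0) + ∑ i ∈ Finset.range (k + 1), fixedCodim ⊤ ((p i)⁻¹ * p (i + 1)) := by
  have hzero : p 0 = π 0 := hp ▸ extendBy_val (cyc N) π 0
  rw [BelowCyc, absLE_reflA, nablaPerm_inv_mul_cyc, fixedCodim_shufflePerm,
    sum_fixedCodim_quotientSeq, hzero, hp, extendBy_self, fixedCodim_cyc, fixedCodim_cyc]
  have hnabla := fixedCodim_top_add_finrank (nablaPerm π)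
  have hfirst := fixedCodim_top_add_finrank (π 0)
  rw [finrank_fixedSpace_nablaPerm, Nat.card_fin] at hnabla
  rw [Nat.card_fin] at hfirst
  have hN : N = 0 → N * (k + 1) = 0 := by
    rintro rfl
    exact zero_mul _
  have hle : N ≤ N * (k + 1) := Nat.le_mul_of_pos_right _ k.succ_pos
  omega

/-- The `k`-multichains below the long cycle. -/
def IsMultichain (π : Fin k → Equiv.Perm (Fin N)) : Prop :=
  (∀ i, BelowCyc (π i)) ∧ ∀ i j, i ≤ j → AbsLE (reflA N) (π i) (π j)

theorem IsMultichain.absLE_extendBy {π : Fin k → Equiv.Perm (Fin N)} (h : IsMultichain π)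
    (i : Fin k) : AbsLE (reflA N) (π i) (extendBy (cyc N) π (i + 1)) := by
  rw [extendBy]
  split_ifs
  exacts [h.2 _ _ (Fin.le_def.2 (Nat.le_succ _)), h.1 i]

theorem IsMultichain.fixedCodim_extendBy {π : Fin k → Equiv.Perm (Fin N)} (h : IsMultichain π)
    {p : ℕ → Equiv.Perm (Fin N)} (hp : p = extendBy (cyc N) π) {m : ℕ} (hm : m ≤ k) :
    fixedCodim ⊤ (p m) =
      fixedCodim ⊤ (p 0) + ∑ i ∈ Finset.range m, fixedCodim ⊤ ((p i)⁻¹ * p (i + 1)) := by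
  induction m with
  | zero => simp
  | succ m ih =>
    have hstep := absLE_reflA.1 (h.absLE_extendBy ⟨m, hm⟩)
    rw [← extendBy_val (cyc N) π ⟨m, hm⟩, ← hp] at hstep
    rw [Finset.sum_range_succ, ← add_assoc, ← ih (by omega)]
    exact hstep

theorem isMultichain_of_fixedCodim_eq {π : Fin k → Equiv.Perm (Fin N)}
    {p : ℕ → Equiv.Perm (Fin N)} (hp : p = extendBy (cyc N) π)
    (h : fixedCodim ⊤ (p k) =
      fixedCodim ⊤ (p 0) + ∑ i ∈ Finset.range k, fixedCodim ⊤ ((p i)⁻¹ * p (i + 1))) :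
    IsMultichain π := by
  have hadd {a b : ℕ} (hab : a ≤ b) (hb : b ≤ k) : AbsLE (reflA N) (p a) (p b) :=
    absLE_reflA.2 (length_eq_add_of_length_eq_add_sum (fixedCodim_one ⊤) (fixedCodim_mul_le ⊤) h
      hab hb)
  subst hp
  refine ⟨fun i => ?_, fun i j hij => ?_⟩
  · have hi := hadd i.2.le le_rfl
    rwa [extendBy_self, extendBy_val] at hi
  · have hj := hadd hij j.2.le
    rwa [extendBy_val, extendBy_val] at hj

theorem isMultichain_iff (π : Fin k → Equiv.Perm (Fin N)) :
    IsMultichain π ↔ BelowCyc (nablaPerm π) := by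
  cases k with
  | zero =>
    have hone : nablaPerm π = 1 := Equiv.ext fun x => x.elim0
    exact iff_of_true ⟨fun i => i.elim0, fun i => i.elim0⟩ (hone ▸ absLE_one_left _ _)
  | succ k =>
    rw [belowCyc_nablaPerm_iff rfl]
    exact ⟨fun h => h.fixedCodim_extendBy rfl le_rfl, isMultichain_of_fixedCodim_eq rfl⟩

theorem commute_nablaPerm_iff {π : Fin k → Equiv.Perm (Fin N)} {m : ℕ} :
    Commute (cyc (N * k) ^ (k * m)) (nablaPerm π) ↔ ∀ i, Commute (cyc N ^ m) (π i) := by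
  have hcyc {M : ℕ} (l : ℕ) : Commute (cyc M ^ l) (cyc M) := (Commute.refl _).pow_left _
  have hshuffle : Commute (cyc (N * k) ^ (k * m)) (nablaPerm π) ↔
      Commute (cyc (N * k) ^ (k * m)) (shufflePerm N k (quotientSeq (cyc N) π)) := by
    refine ⟨fun h => ?_, fun h => (hcyc _).mul_right h.inv_right⟩
    rw [← nablaPerm_inv_mul_cyc]
    exact h.inv_right.mul_right (hcyc _)
  have hmem (u : Equiv.Perm (Fin N)) :
      u ∈ Subgroup.centralizer {cyc N ^ m} ↔ Commute (cyc N ^ m) u :=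
    Subgroup.mem_centralizer_singleton_iff.trans eq_comm
  rw [hshuffle, cyc_pow_mul, commute_shufflePerm_iff]
  simp only [← hmem]
  exact quotientSeq_mem_iff ((hmem _).2 (hcyc m))

end Nabla

/-! ### Odd functions and the length of signed permutations -/

section OddSpace

variable {X : Type*}

/-- The space of functions that change sign under `a`. When `a` is a fixed-point-free involution,
the permutations commuting with `a` act on it as signed permutation matrices. -/
def oddSpace (a : Equiv.Perm X) : Submodule ℚ (X → ℚ) where
  carrier := {f | ∀ x, f (a x) = -f x}
  add_mem' hf hg x := by simp [hf x, hg x, add_comm]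
  zero_mem' x := by simp
  smul_mem' c f hf x := by simp [hf x]

variable {a w : Equiv.Perm X}

theorem fixedSpace_inf_oddSpace (a : Equiv.Perm X) : fixedSpace a ⊓ oddSpace a = ⊥ := by
  rw [eq_bot_iff]
  rintro f ⟨hfix, hodd⟩
  ext x
  have := (hfix x).symm.trans (hodd x)
  simp only [Pi.zero_apply]
  linarith

theorem inf_fixedSpace_sup_inf_oddSpace (ha : Function.Involutive a)
    {S : Submodule ℚ (X → ℚ)} (hS : ∀ f ∈ S, f ∘ a ∈ S) :
    (S ⊓ fixedSpace a) ⊔ (S ⊓ oddSpace a) = S := by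
  refine le_antisymm (sup_le inf_le_left inf_le_left) fun f hf => ?_
  have hfa := hS f hf
  refine Submodule.mem_sup.2 ⟨(2⁻¹ : ℚ) • (f + f ∘ a), ⟨S.smul_mem _ (S.add_mem hf hfa), ?_⟩,
    (2⁻¹ : ℚ) • (f - f ∘ a), ⟨S.smul_mem _ (S.sub_mem hf hfa), ?_⟩, ?_⟩
  · intro x
    simp [ha x, add_comm]
  · intro x
    simp only [Pi.smul_apply, Pi.sub_apply, Function.comp_apply, ha x, smul_eq_mul]
    ring
  · ext x
    simp only [Pi.smul_apply, Pi.sub_apply, Pi.add_apply, Function.comp_apply, smul_eq_mul]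
    ring

theorem finrank_eq_fixedSpace_add_oddSpace [Finite X] (ha : Function.Involutive a)
    {S : Submodule ℚ (X → ℚ)} (hS : ∀ f ∈ S, f ∘ a ∈ S) :
    finrank ℚ S = finrank ℚ (S ⊓ fixedSpace a : Submodule ℚ (X → ℚ)) +
      finrank ℚ (S ⊓ oddSpace a : Submodule ℚ (X → ℚ)) := by
  have h := Submodule.finrank_sup_add_finrank_inf_eq (S ⊓ fixedSpace a) (S ⊓ oddSpace a)
  rwa [inf_fixedSpace_sup_inf_oddSpace ha hS, ← inf_inf_distrib_left, fixedSpace_inf_oddSpace,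
    inf_bot_eq, finrank_bot] at h

theorem fixedCodim_eq_fixedSpace_add_oddSpace [Finite X] (ha : Function.Involutive a)
    (hw : Commute a w) :
    fixedCodim ⊤ w = fixedCodim (fixedSpace a) w + fixedCodim (oddSpace a) w := by
  have htop := finrank_eq_fixedSpace_add_oddSpace ha (S := ⊤) fun _ _ => trivial
  have hfix := finrank_eq_fixedSpace_add_oddSpace ha (S := fixedSpace w) fun f hf x => by
    have : a (w x) = w (a x) := DFunLike.congr_fun hw.eq x
    rw [Function.comp_apply, this, hf, Function.comp_apply]
  have := fixedCodim_add_finrank (fixedSpace a) w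
  have := fixedCodim_add_finrank (oddSpace a) w
  have := fixedCodim_add_finrank ⊤ w
  rw [top_inf_eq, top_inf_eq] at htop
  rw [inf_top_eq] at this
  omega

variable [DecidableEq X]

theorem commute_swap_apply_self (ha : Function.Involutive a) (i : X) :
    Commute a (Equiv.swap i (a i)) := by
  rw [commute_iff_eq, Equiv.mul_swap_eq_swap_mul, ha, Equiv.swap_comm]

theorem commute_swap_swap (ha : Function.Involutive a) (hfree : ∀ x, a x ≠ x) {i j : X}
    (hji : j ≠ i) (hj : j ≠ a i) : Commute (Equiv.swap i j) (Equiv.swap (a i) (a j)) := by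
  have hij : i ≠ a j := fun h => hj (by rw [h, ha])
  refine (disjoint_swap_swap ?_).commute
  simp [hji.symm, (hfree i).symm, hij, hj, (hfree j).symm]

theorem commute_swap_mul_swap (ha : Function.Involutive a) (hfree : ∀ x, a x ≠ x) {i j : X}
    (hji : j ≠ i) (hj : j ≠ a i) : Commute a (Equiv.swap i j * Equiv.swap (a i) (a j)) := by
  rw [commute_iff_eq, ← mul_assoc, Equiv.mul_swap_eq_swap_mul a i, mul_assoc,
    Equiv.mul_swap_eq_swap_mul a (a i), ha, ha, ← mul_assoc, (commute_swap_swap ha hfree hji hj).eq]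

theorem swap_mul_swap_mul_self (ha : Function.Involutive a) (hfree : ∀ x, a x ≠ x) {i j : X}
    (hji : j ≠ i) (hj : j ≠ a i) :
    Equiv.swap i j * Equiv.swap (a i) (a j) * (Equiv.swap i j * Equiv.swap (a i) (a j)) = 1 := by
  rw [(commute_swap_swap ha hfree hji hj).symm.mul_mul_mul_comm, Equiv.swap_mul_self,
    Equiv.swap_mul_self, one_mul]

theorem mem_fixedSpace_swap_mul_swap {i j : X} {f : X → ℚ} (hf : f ∈ oddSpace a)
    (h : f i = f j) : f ∈ fixedSpace (Equiv.swap i j * Equiv.swap (a i) (a j)) :=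
  fixedSpace_inf_le_mul _ _ ⟨mem_fixedSpace_swap h, mem_fixedSpace_swap (by rw [hf, hf, h])⟩

theorem single_sub_single_mem_oddSpace (ha : Function.Involutive a) (x : X) :
    (Pi.single x 1 - Pi.single (a x) 1 : X → ℚ) ∈ oddSpace a := fun z => by
  have : a z = x ↔ z = a x := ha.eq_iff
  simp only [Pi.sub_apply, Pi.single_apply, this, EmbeddingLike.apply_eq_iff_eq]
  ring

end OddSpace

theorem fixedCodim_oddSpace_mul_lt {X : Type*} [Finite X] {a w t : Equiv.Perm X}
    (ha : Function.Involutive a) (hfree : ∀ x, a x ≠ x) (hw : Commute a w) (ht : Commute a t)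
    {x : X} (hx : w x ≠ x) (htw : t (w x) = x)
    (hfix : ∀ f ∈ oddSpace a, f x = f (w x) → f ∈ fixedSpace t) :
    fixedCodim (oddSpace a) (t * w) < fixedCodim (oddSpace a) w := by
  classical
  have htwa : (t * w) (a x) = a x := by
    rw [← mul_apply, ← (ht.mul_right hw).eq, mul_apply, mul_apply, htw]
  refine fixedCodim_lt ?_ (single_sub_single_mem_oddSpace ha x)
    (sub_mem (single_mem_fixedSpace htw) (single_mem_fixedSpace htwa)) fun h => ?_
  · rintro f ⟨hf, hodd⟩
    exact fixedSpace_inf_le_mul _ _ ⟨hfix f hodd (hf x).symm, hf⟩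
  · have := h x
    simp only [Pi.sub_apply, Pi.single_apply, hx, if_false, if_true, (hfree x).symm] at this
    split_ifs at this <;> norm_num at this

section TypeB

variable {n : ℕ}

theorem antipode_eq (n : ℕ) : antipode (2 * n) = cyc (2 * n) ^ n := by
  rw [antipode, Nat.mul_div_cancel_left n two_pos]
  rfl

theorem antipode_val (x : Fin (2 * n)) : (antipode (2 * n) x : ℕ) = (x + n) % (2 * n) := by
  rw [antipode_eq, cyc_pow_val]

theorem involutive_antipode (n : ℕ) : Function.Involutive (antipode (2 * n)) := fun x => by
  rw [antipode_eq, ← mul_apply, ← pow_add]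
  ext
  rw [cyc_pow_val, ← two_mul, Nat.add_mod_right, Nat.mod_eq_of_lt x.2]

theorem antipode_ne (x : Fin (2 * n)) : antipode (2 * n) x ≠ x := fun h => by
  have hval := congrArg Fin.val h
  have hx := x.2
  rw [antipode_val] at hval
  rcases Nat.lt_or_ge (x + n) (2 * n) with hlt | hge
  · rw [Nat.mod_eq_of_lt hlt] at hval
    omega
  · rw [Nat.mod_eq_sub_mod hge, Nat.mod_eq_of_lt (by omega)] at hval
    omega

theorem mem_signedPerm {w : Equiv.Perm (Fin (2 * n))} :
    w ∈ signedPerm n ↔ Commute (antipode (2 * n)) w := by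
  rw [signedPerm, Subgroup.mem_centralizer_singleton_iff, commute_iff_eq, eq_comm]

/-- The codimension in the space of odd functions of those fixed by the signed permutation `w`.
It is the word length of `w` in the reflections of `B_n`. -/
noncomputable def oddCodim (w : signedPerm n) : ℕ :=
  fixedCodim (oddSpace (antipode (2 * n))) w.1

theorem oddCodim_mul_le (u v : signedPerm n) : oddCodim (u * v) ≤ oddCodim u + oddCodim v :=
  fixedCodim_mul_le _ u.1 v.1

theorem oddCodim_le_one {t : signedPerm n} (ht : t ∈ reflB n) : oddCodim t ≤ 1 := by
  rcases ht with ⟨i, ht⟩ | ⟨i, j, -, -, ht⟩ <;> rw [oddCodim, ht]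
  · exact fixedCodim_le_one i _ fun f _ => mem_fixedSpace_swap
  · exact fixedCodim_le_one i j fun f => mem_fixedSpace_swap_mul_swap

theorem fixedCodim_top_le_two {t : signedPerm n} (ht : t ∈ reflB n) : fixedCodim ⊤ t.1 ≤ 2 := by
  have hswap (i j : Fin (2 * n)) : fixedCodim ⊤ (Equiv.swap i j) ≤ 1 :=
    fixedCodim_le_one i j fun _ _ => mem_fixedSpace_swap
  rcases ht with ⟨i, ht⟩ | ⟨i, j, -, -, ht⟩ <;> rw [ht]
  · exact (hswap _ _).trans one_le_two
  · exact (fixedCodim_mul_le _ _ _).trans (add_le_add (hswap _ _) (hswap _ _))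

theorem exists_reflB_mul_oddCodim_lt {w : signedPerm n} (hw : w ≠ 1) :
    ∃ t ∈ reflB n, t * t = 1 ∧ oddCodim (t * w) < oddCodim w := by
  have ha := involutive_antipode n
  have hwa := mem_signedPerm.1 w.2
  obtain ⟨x, hx⟩ : ∃ x, w.1 x ≠ x := by
    by_contra! h
    exact hw (Subtype.ext (Equiv.ext h))
  by_cases hax : w.1 x = antipode (2 * n) x
  · have ht := commute_swap_apply_self ha x
    refine ⟨⟨_, mem_signedPerm.2 ht⟩, .inl ⟨x, rfl⟩, Subtype.ext (Equiv.swap_mul_self _ _),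
      fixedCodim_oddSpace_mul_lt ha antipode_ne hwa ht hx ?_ fun f _ hf => ?_⟩
    · rw [hax, Equiv.swap_apply_right]
    · exact mem_fixedSpace_swap (hf.trans (congrArg f hax))
  · have ht := commute_swap_mul_swap ha antipode_ne hx hax
    refine ⟨⟨_, mem_signedPerm.2 ht⟩, .inr ⟨x, w.1 x, hx, hax, rfl⟩,
      Subtype.ext (swap_mul_swap_mul_self ha antipode_ne hx hax),
      fixedCodim_oddSpace_mul_lt ha antipode_ne hwa ht hx ?_
        fun f => mem_fixedSpace_swap_mul_swap⟩
    rw [mul_apply, Equiv.swap_apply_of_ne_of_ne hax (antipode_ne _).symm, Equiv.swap_apply_right]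

theorem wordLength_reflB (w : signedPerm n) : wordLength (reflB n) w = oddCodim w :=
  wordLength_eq_of_descent (r := oddCodim) (fixedCodim_one _) oddCodim_mul_le
    (fun _ => oddCodim_le_one) (fun _ => exists_reflB_mul_oddCodim_lt) w

theorem fixedCodim_le_two_mul_oddCodim (w : signedPerm n) : fixedCodim ⊤ w.1 ≤ 2 * oddCodim w := by
  obtain ⟨l, hl, hlen, hprod⟩ :=
    exists_list_prod_eq_of_descent (fun _ => exists_reflB_mul_oddCodim_lt) w
  calc fixedCodim ⊤ w.1 = fixedCodim ⊤ l.prod.1 := by rw [hprod]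
    _ ≤ 2 * l.length :=
      map_list_prod_le_mul_length (r := fun w : signedPerm n => fixedCodim ⊤ w.1)
        (fixedCodim_one ⊤) (fun u v => fixedCodim_mul_le ⊤ u.1 v.1)
        (fun _ => fixedCodim_top_le_two) hl
    _ ≤ 2 * oddCodim w := Nat.mul_le_mul_left 2 hlen

theorem absLE_reflB_of_reflA {u v : signedPerm n} (h : AbsLE (reflA (2 * n)) u.1 v.1) :
    AbsLE (reflB n) u v := by
  have hsplit (w : signedPerm n) := fixedCodim_eq_fixedSpace_add_oddSpace
    (involutive_antipode n) (mem_signedPerm.1 w.2)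
  have hu := hsplit u
  have hv := hsplit v
  have huv := hsplit (u⁻¹ * v)
  have heven := fixedCodim_mul_le (fixedSpace (antipode (2 * n))) u.1 (u⁻¹ * v).1
  have hodd := oddCodim_mul_le u (u⁻¹ * v)
  have hA : _ = _ + fixedCodim ⊤ (u⁻¹ * v).1 := absLE_reflA.1 h
  rw [← Subgroup.coe_mul, mul_inv_cancel_left] at heven
  rw [mul_inv_cancel_left] at hodd
  simp only [AbsLE, wordLength_reflB]
  unfold oddCodim at hodd ⊢
  omega

/-- The signed permutations with at most one cycle that is its own antipode: every other cycle is
paired with its antipode, and the difference `2 * oddCodim w - fixedCodim ⊤ w` counts the cycles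
that are their own antipodes. -/
def HasAtMostOneZeroCycle (w : signedPerm n) : Prop := 2 * oddCodim w ≤ fixedCodim ⊤ w.1 + 1

theorem HasAtMostOneZeroCycle.of_absLE {u v : signedPerm n} (hv : HasAtMostOneZeroCycle v)
    (h : AbsLE (reflB n) u v) : AbsLE (reflA (2 * n)) u.1 v.1 ∧
      HasAtMostOneZeroCycle u ∧ HasAtMostOneZeroCycle (u⁻¹ * v) := by
  simp only [AbsLE, wordLength_reflB] at h
  have hu2 := fixedCodim_le_two_mul_oddCodim u
  have huv2 := fixedCodim_le_two_mul_oddCodim (u⁻¹ * v)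
  have hle := fixedCodim_mul_le ⊤ u.1 (u⁻¹ * v).1
  have hsign : sign v.1 = sign u.1 * sign (u⁻¹ * v).1 := by
    rw [← map_mul, ← Subgroup.coe_mul, mul_inv_cancel_left]
  rw [← Subgroup.coe_mul, mul_inv_cancel_left] at hle
  simp only [sign_eq_neg_one_pow_fixedCodim, ← pow_add] at hsign
  -- The sign excludes the one case that the inequalities between the two lengths leave open.
  have hparity : fixedCodim ⊤ u.1 + fixedCodim ⊤ (u⁻¹ * v).1 ≠ fixedCodim ⊤ v.1 + 1 := by
    intro hsum
    rw [hsum, pow_succ] at hsign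
    exact absurd (mul_eq_left.1 hsign.symm) (by decide)
  have hA : fixedCodim ⊤ v.1 = fixedCodim ⊤ u.1 + fixedCodim ⊤ (u⁻¹ * v).1 := by
    unfold HasAtMostOneZeroCycle at hv
    omega
  refine ⟨absLE_reflA.2 hA, ?_⟩
  unfold HasAtMostOneZeroCycle at *
  omega

theorem finrank_oddSpace_antipode_le (n : ℕ) : finrank ℚ (oddSpace (antipode (2 * n))) ≤ n := by
  let ι : Fin n → Fin (2 * n) := Fin.castLE (Nat.le_mul_of_pos_left n two_pos)
  let restrict : oddSpace (antipode (2 * n)) →ₗ[ℚ] (Fin n → ℚ) :=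
    (LinearMap.funLeft ℚ ℚ ι).comp (oddSpace (antipode (2 * n))).subtype
  have hinj : Function.Injective restrict := by
    rw [← LinearMap.ker_eq_bot, eq_bot_iff]
    intro f hf
    have hzero (i : Fin n) : f.1 (ι i) = 0 := congrFun (LinearMap.mem_ker.1 hf) i
    refine Subtype.ext (funext fun x => ?_)
    rcases Nat.lt_or_ge x n with hlt | hge
    · exact hzero ⟨x, hlt⟩
    · have hx : x = antipode (2 * n) (ι ⟨x - n, by omega⟩) := by
        ext
        rw [antipode_val, Fin.val_castLE, Nat.sub_add_cancel hge, Nat.mod_eq_of_lt x.2]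
      rw [hx, f.2, hzero, neg_zero]
      rfl
  simpa using LinearMap.finrank_le_finrank_of_injective hinj

theorem hasAtMostOneZeroCycle_cycB (n : ℕ) : HasAtMostOneZeroCycle (cycB n) := by
  have htop : fixedCodim ⊤ (cycB n).1 = 2 * n - 1 := fixedCodim_cyc (2 * n)
  have hodd : oddCodim (cycB n) ≤ n :=
    (Nat.sub_le _ _).trans (finrank_oddSpace_antipode_le n)
  rw [HasAtMostOneZeroCycle]
  omega

theorem absLE_reflB_iff {u v : signedPerm n} (hv : HasAtMostOneZeroCycle v) :
    AbsLE (reflB n) u v ↔ AbsLE (reflA (2 * n)) u.1 v.1 :=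
  ⟨fun h => (hv.of_absLE h).1, absLE_reflB_of_reflA⟩

end TypeB

/-! ### Divisibility of the block sizes -/

section Divisibility

variable {X : Type*} [Finite X] {k : ℕ}

theorem dvd_ncard_sameCycle_of_modEq_succ {w : Equiv.Perm X} {r : X → ℕ}
    (h : ∀ x, r (w x) ≡ r x + 1 [MOD k]) (x : X) : k ∣ {y | w.SameCycle y x}.ncard := by
  have hpow (m : ℕ) : r ((w ^ m) x) ≡ r x + m [MOD k] := by
    induction m with
    | zero => rfl
    | succ m ih =>
      rw [pow_succ', mul_apply]
      exact (h _).trans (ih.add_right 1)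
  have horbit : {y | w.SameCycle y x} = MulAction.orbit (Subgroup.zpowers w) x := by
    ext y
    constructor
    · intro hy
      obtain ⟨i, hi⟩ := SameCycle.symm hy
      exact ⟨⟨w ^ i, i, rfl⟩, hi⟩
    · rintro ⟨⟨_, i, rfl⟩, hi⟩
      exact SameCycle.symm ⟨i, hi⟩
  have := Fintype.ofFinite (MulAction.orbit (Subgroup.zpowers w) x)
  rw [horbit, ← Nat.card_coe_set_eq, Nat.card_eq_fintype_card, ← MulAction.minimalPeriod_eq_card]
  have hreturn := hpow (Function.minimalPeriod (w • ·) x)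
  have hperiod : (w ^ Function.minimalPeriod (w • ·) x) x = x :=
    (MulAction.pow_smul_eq_iff_minimalPeriod_dvd (a := w) (b := x)).2 dvd_rfl
  rw [hperiod] at hreturn
  exact (Nat.modEq_zero_iff_dvd).1 (Nat.ModEq.add_left_cancel' _ hreturn.symm)

theorem dvd_ncard_of_forall_dvd_ncard_classes {P : Setoid X} (hP : ∀ B ∈ P.classes, k ∣ B.ncard)
    {S : Set X} (hS : ∀ x y, P x y → x ∈ S → y ∈ S) : k ∣ S.ncard := by
  classical
  have := Fintype.ofFinite X
  have := Fintype.ofFinite (Quotient P)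
  rw [Set.ncard_eq_toFinset_card', Finset.card_eq_sum_card_fiberwise
    (f := fun x => (Quotient.mk P x)) (t := Finset.univ) fun _ _ => Finset.mem_univ _]
  refine Finset.dvd_sum fun q _ => ?_
  induction q using Quotient.ind with | _ x
  by_cases hx : x ∈ S
  · have hclass := hP _ (P.mem_classes x)
    rw [Set.ncard_eq_toFinset_card'] at hclass
    refine hclass.trans (dvd_of_eq (congrArg Finset.card (Finset.ext fun y => ?_)))
    simp only [Finset.mem_filter, Set.mem_toFinset, Quotient.eq, Set.mem_ofPred_eq]
    exact ⟨fun h => ⟨hS x y (P.symm' h) hx, h⟩, fun h => h.2⟩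
  · rw [Finset.card_eq_zero.2]
    · exact dvd_zero k
    · ext y
      simp only [Finset.mem_filter, Set.mem_toFinset, Quotient.eq, Finset.notMem_empty, iff_false]
      exact fun h => hx (hS y x h.2 h.1)

end Divisibility

section DivisibleNC

variable {N k : ℕ}

theorem Divisible.modEq_of_krewerasAux {P : Setoid (Fin N)} (hP : Divisible k P)
    {i j : Fin N} (h : krewerasAux P i j) : (i : ℕ) ≡ j [MOD k] := by
  wlog hij : i ≤ j generalizing i j
  · exact (this (Setoid.symm' _ h) (le_of_not_ge hij)).symm
  have hdvd : k ∣ (Set.Ioc i j).ncard := dvd_ncard_of_forall_dvd_ncard_classes hP fun a b hab => by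
    have hK := h a b hab
    simp only [Set.mem_Ioc, Fin.le_def, Fin.lt_def] at hK hij ⊢
    omega
  rw [Set.ncard_eq_toFinset_card', Set.toFinset_Ioc, Fin.card_Ioc] at hdvd
  exact (Nat.modEq_iff_dvd' hij).2 hdvd

theorem shufflePerm_modEq (δ : Fin k → Equiv.Perm (Fin N)) (x : Fin (N * k)) :
    (shufflePerm N k δ x : ℕ) ≡ x [MOD k] := by
  obtain ⟨⟨j, i⟩, rfl⟩ := finProdFinEquiv.surjective x
  rw [shufflePerm_apply]
  simp [Nat.ModEq]

theorem exists_shufflePerm_eq {w : Equiv.Perm (Fin (N * k))} (hw : ∀ x, (w x : ℕ) ≡ x [MOD k]) :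
    ∃ δ, shufflePerm N k δ = w := by
  have hmod (j : Fin N) (i : Fin k) : (w (finProdFinEquiv (j, i))).modNat = i := Fin.ext <| by
    rw [Fin.coe_modNat, hw (finProdFinEquiv (j, i)), finProdFinEquiv_apply_val]
    simp [Nat.mod_eq_of_lt i.2]
  have happly (j : Fin N) (i : Fin k) :
      finProdFinEquiv ((w (finProdFinEquiv (j, i))).divNat, i) = w (finProdFinEquiv (j, i)) := by
    have := finProdFinEquiv.apply_symm_apply (w (finProdFinEquiv (j, i)))
    rwa [finProdFinEquiv_symm_apply, hmod] at this
  have hinj (i : Fin k) : Function.Injective fun j => (w (finProdFinEquiv (j, i))).divNat := by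
    intro j j' (h : (w _).divNat = (w _).divNat)
    have hw := happly j i
    rw [h, happly j' i] at hw
    simpa using hw.symm
  refine ⟨fun i => Equiv.ofBijective _ (Finite.injective_iff_bijective.1 (hinj i)), ?_⟩
  ext1 x
  obtain ⟨⟨j, i⟩, rfl⟩ := finProdFinEquiv.surjective x
  rw [shufflePerm_apply]
  exact happly j i

theorem absLE_shufflePerm_iff {δ ε : Fin k → Equiv.Perm (Fin N)} :
    AbsLE (reflA (N * k)) (shufflePerm N k δ) (shufflePerm N k ε) ↔
      ∀ i, AbsLE (reflA N) (δ i) (ε i) := by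
  have hle (i : Fin k) : fixedCodim ⊤ (ε i) ≤
      fixedCodim ⊤ (δ i) + fixedCodim ⊤ ((δ i)⁻¹ * ε i) := by
    simpa using fixedCodim_mul_le ⊤ (δ i) ((δ i)⁻¹ * ε i)
  simp only [absLE_reflA, ← map_inv, ← map_mul, fixedCodim_shufflePerm, Pi.mul_apply,
    Pi.inv_apply, ← Finset.sum_add_distrib, Finset.sum_eq_sum_iff_of_le fun i _ => hle i,
    Finset.mem_univ, forall_const]

theorem divisible_orbitPartition_nablaPerm (π : Fin k → Equiv.Perm (Fin N)) :
    Divisible k (orbitPartition (nablaPerm π)) := by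
  rintro _ ⟨x, rfl⟩
  refine dvd_ncard_sameCycle_of_modEq_succ (r := fun x : Fin (N * k) => (x : ℕ)) (fun x => ?_) x
  rw [nablaPerm, mul_apply, cyc_val, ← map_inv]
  exact ((Nat.mod_modEq _ _).of_mul_left N).trans ((shufflePerm_modEq _ x).add_right 1)

theorem exists_orbitPartition_nablaPerm_eq {P : Setoid (Fin (N * k))} (hP : Noncrossing P)
    (hk : Divisible k P) : ∃ π : Fin k → Equiv.Perm (Fin N),
      BelowCyc (nablaPerm π) ∧ orbitPartition (nablaPerm π) = P := by
  obtain ⟨w, hw, rfl⟩ := hP.exists_belowCyc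
  have hmod (x : Fin (N * k)) : ((w⁻¹ * cyc (N * k)) x : ℕ) ≡ x [MOD k] := by
    refine hk.modEq_of_krewerasAux ?_
    rw [hw.krewerasAux_eq]
    exact (SameCycle.refl _ x).apply_left
  obtain ⟨δ, hδ⟩ := exists_shufflePerm_eq hmod
  obtain ⟨π, rfl⟩ := quotientSeq_surjective (c := cyc N) δ
  have hπ : nablaPerm π = w := by
    rw [nablaPerm, hδ]
    group
  exact ⟨π, hπ ▸ hw, by rw [hπ]⟩

theorem IsMultichain.classicalDelta_eq {π : Fin k → Equiv.Perm (Fin N)} (h : IsMultichain π)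
    (i : Fin k) : classicalDelta (fun i => orbitPartition (π i)) i =
      orbitPartition (quotientSeq (cyc N) π i) := by
  rw [classicalDelta, quotientSeq, extendBy]
  split_ifs
  · exact (h.1 _).relKreweras_eq (h.2 _ _ (Fin.le_def.2 (Nat.le_succ _)))
  · exact (h.1 i).kreweras_eq

theorem IsMultichain.shuffleFin_classicalDelta {π : Fin k → Equiv.Perm (Fin N)}
    (h : IsMultichain π) : shuffleFin (classicalDelta fun i => orbitPartition (π i)) =
      orbitPartition ((nablaPerm π)⁻¹ * cyc (N * k)) := by
  rw [nablaPerm_inv_mul_cyc, orbitPartition_shufflePerm]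
  exact congrArg shuffleFin (funext h.classicalDelta_eq)

theorem orbitPartition_nablaPerm_le_iff {π μ : Fin k → Equiv.Perm (Fin N)}
    (hπ : BelowCyc (nablaPerm π)) (hμ : BelowCyc (nablaPerm μ)) :
    orbitPartition (nablaPerm π) ≤ orbitPartition (nablaPerm μ) ↔
      ∀ i, AbsLE (reflA N) (quotientSeq (cyc N) μ i) (quotientSeq (cyc N) π i) := by
  rw [← krewerasAux_le_iff hπ.noncrossing hμ.noncrossing, hπ.krewerasAux_eq, hμ.krewerasAux_eq,
    ← hμ.inv_mul_cyc.absLE_iff_orbitPartition_le hπ.inv_mul_cyc, nablaPerm_inv_mul_cyc,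
    nablaPerm_inv_mul_cyc, absLE_shufflePerm_iff]

end DivisibleNC

/-! ### Noncrossing partitions of type `B` -/

section NoncrossingTypeB

theorem NCGroup.belowCyc {N : ℕ} (w : NCGroup (reflA N) (cyc N)) : BelowCyc w.1 :=
  w.2.2

theorem NCGroup.le_iff_orbitPartition_le {N : ℕ} {u v : NCGroup (reflA N) (cyc N)} :
    u ≤ v ↔ orbitPartition u.1 ≤ orbitPartition v.1 :=
  u.belowCyc.absLE_iff_orbitPartition_le v.belowCyc

theorem Noncrossing.comap_cyc_pow {N : ℕ} {P : Setoid (Fin N)} (hP : Noncrossing P) (m : ℕ) :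
    Noncrossing (P.comap (cyc N ^ m)) := by
  obtain ⟨u, hu, rfl⟩ := hP.exists_belowCyc
  have hcomap : (orbitPartition u).comap (cyc N ^ m) =
      orbitPartition ((cyc N ^ m)⁻¹ * u * (cyc N ^ m)⁻¹⁻¹) := by
    ext x y
    rw [Setoid.comap_rel, ← orbitPartition_conj (cyc N ^ m)⁻¹ u]
    simp only [coe_inv, Equiv.symm_apply_apply]
  rw [hcomap]
  exact (hu.conj ((Commute.refl _).pow_left m).inv_left).noncrossing

variable {n k : ℕ}

theorem mem_signedPerm_iff_conj {w : Equiv.Perm (Fin (2 * n))} :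
    w ∈ signedPerm n ↔ cyc (2 * n) ^ n * w * (cyc (2 * n) ^ n)⁻¹ = w := by
  rw [mem_signedPerm, antipode_eq, commute_iff_eq, mul_inv_eq_iff_eq_mul]

theorem absLE_cycB_iff {w : signedPerm n} : AbsLE (reflB n) w (cycB n) ↔ BelowCyc w.1 :=
  absLE_reflB_iff (hasAtMostOneZeroCycle_cycB n)

theorem NCGroup.hasAtMostOneZeroCycle (w : NCGroup (reflB n) (cycB n)) :
    HasAtMostOneZeroCycle w.1 :=
  ((hasAtMostOneZeroCycle_cycB n).of_absLE w.2.2).2.1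

/-- The embedding of `NC(B_n)` into `NC(A_{2n-1})` given by the inclusion of groups. -/
def typeBEmbedding (n : ℕ) :
    NCGroup (reflB n) (cycB n) ↪o NCGroup (reflA (2 * n)) (cyc (2 * n)) where
  toFun w := ⟨w.1.1, absLE_one_left _ _, absLE_cycB_iff.1 w.2.2⟩
  inj' _ _ h := Subtype.ext (Subtype.ext (Subtype.mk.inj h))
  map_rel_iff' {_ v} := (absLE_reflB_iff v.hasAtMostOneZeroCycle).symm

theorem mem_range_typeBEmbedding {w : NCGroup (reflA (2 * n)) (cyc (2 * n))} :
    w ∈ Set.range (typeBEmbedding n) ↔ w.1 ∈ signedPerm n := by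
  refine ⟨?_, fun hw => ⟨⟨⟨w.1, hw⟩, absLE_one_left _ _, absLE_cycB_iff.2 w.belowCyc⟩, rfl⟩⟩
  rintro ⟨v, rfl⟩
  exact v.1.2

theorem orbitPartition_antipode (w : signedPerm n) (x y : Fin (2 * n)) :
    orbitPartition w.1 (antipode _ x) (antipode _ y) ↔ orbitPartition w.1 x y := by
  have hconj : antipode (2 * n) * w.1 * (antipode (2 * n))⁻¹ = w.1 :=
    mul_inv_eq_iff_eq_mul.2 (mem_signedPerm.1 w.2)
  have h := orbitPartition_conj (antipode (2 * n)) w.1 x y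
  rwa [hconj] at h

theorem exists_orbitPartition_typeBEmbedding_eq {P : Setoid (Fin (2 * n))} (hP : Noncrossing P)
    (hantipode : ∀ x y, P x y → P (antipode _ x) (antipode _ y)) :
    ∃ w, orbitPartition (typeBEmbedding n w).1 = P := by
  obtain ⟨u, hu, rfl⟩ := hP.exists_belowCyc
  have hmem : u ∈ signedPerm n := by
    rw [mem_signedPerm, hu.commute_iff (antipode_eq n ▸ (Commute.refl _).pow_left n)]
    refine fun x y => ⟨fun h => ?_, hantipode x y⟩
    simpa only [involutive_antipode n _] using hantipode _ _ h
  obtain ⟨w, hw⟩ := (mem_range_typeBEmbedding (w := ⟨u, absLE_one_left _ _, hu⟩)).2 hmem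
  exact ⟨w, by rw [hw]⟩

theorem exists_isGLB_typeBEmbedding (u v : NCGroup (reflB n) (cycB n)) :
    ∃ m, IsGLB {typeBEmbedding n u, typeBEmbedding n v} (typeBEmbedding n m) := by
  obtain ⟨m, hm⟩ := exists_orbitPartition_typeBEmbedding_eq
    (P := orbitPartition u.1.1 ⊓ orbitPartition v.1.1)
    (fun a b c d hab hbc hcd hac hbd =>
      ⟨(typeBEmbedding n u).belowCyc.noncrossing a b c d hab hbc hcd hac.1 hbd.1,
        (typeBEmbedding n v).belowCyc.noncrossing a b c d hab hbc hcd hac.2 hbd.2⟩)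
    (fun x y h => ⟨(orbitPartition_antipode u.1 x y).2 h.1,
      (orbitPartition_antipode v.1 x y).2 h.2⟩)
  refine ⟨m, ?_, fun w hw => ?_⟩
  · rintro _ (rfl | rfl) <;> rw [NCGroup.le_iff_orbitPartition_le, hm]
    exacts [inf_le_left, inf_le_right]
  · rw [NCGroup.le_iff_orbitPartition_le, hm]
    exact le_inf (NCGroup.le_iff_orbitPartition_le.1 (hw (Set.mem_insert _ _)))
      (NCGroup.le_iff_orbitPartition_le.1 (hw (Set.mem_insert_of_mem _ rfl)))

theorem exists_isLUB_typeBEmbedding (u v : NCGroup (reflB n) (cycB n)) :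
    ∃ j, IsLUB {typeBEmbedding n u, typeBEmbedding n v} (typeBEmbedding n j) := by
  obtain ⟨j, hj⟩ := exists_orbitPartition_typeBEmbedding_eq
    (P := sInf {Q | Noncrossing Q ∧ orbitPartition u.1.1 ≤ Q ∧ orbitPartition v.1.1 ≤ Q})
    (fun a b c d hab hbc hcd hac hbd Q hQ => hQ.1 a b c d hab hbc hcd (hac Q hQ) (hbd Q hQ))
    (fun x y h Q hQ => h (Q.comap (antipode (2 * n)))
      ⟨antipode_eq n ▸ hQ.1.comap_cyc_pow n,
        fun {a b} hab => hQ.2.1 ((orbitPartition_antipode u.1 a b).2 hab),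
        fun {a b} hab => hQ.2.2 ((orbitPartition_antipode v.1 a b).2 hab)⟩)
  refine ⟨j, ?_, fun w hw => ?_⟩
  · rintro _ (rfl | rfl) <;> rw [NCGroup.le_iff_orbitPartition_le, hj]
    exacts [le_sInf fun _ hQ => hQ.2.1, le_sInf fun _ hQ => hQ.2.2]
  · rw [NCGroup.le_iff_orbitPartition_le, hj]
    exact sInf_le ⟨w.belowCyc.noncrossing,
      NCGroup.le_iff_orbitPartition_le.1 (hw (Set.mem_insert _ _)),
      NCGroup.le_iff_orbitPartition_le.1 (hw (Set.mem_insert_of_mem _ rfl))⟩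

theorem delta_reflB_coe (π : NCGroupDiv (reflB n) (cycB n) k) (i : Fin k) :
    (delta π i).1 = quotientSeq (cyc (2 * n)) (fun i => (π.1 i).1.1) i := by
  rw [delta, quotientSeq, extendBy]
  split_ifs <;> rfl

theorem hasAtMostOneZeroCycle_delta (π : NCGroupDiv (reflB n) (cycB n) k) (i : Fin k) :
    HasAtMostOneZeroCycle (delta π i) := by
  rw [delta]
  split_ifs with h
  · exact ((π.1 _).hasAtMostOneZeroCycle.of_absLE (π.2 _ _ (Fin.le_def.2 (Nat.le_succ _)))).2.2
  · exact ((hasAtMostOneZeroCycle_cycB n).of_absLE (π.1 i).2.2).2.2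

/-- The embedding of `NC^{(k)}(B_n)` into `NC^{(k)}(A_{2n-1})` that applies `typeBEmbedding n` to
each entry of a multichain. -/
def typeBDivEmbedding (n k : ℕ) :
    NCGroupDiv (reflB n) (cycB n) k ↪o NCGroupDiv (reflA (2 * n)) (cyc (2 * n)) k where
  toFun π := ⟨fun i => typeBEmbedding n (π.1 i),
    fun i j hij => (typeBEmbedding n).map_rel_iff.2 (π.2 i j hij)⟩
  inj' π μ h := Subtype.ext (funext fun i =>
    (typeBEmbedding n).injective (congrFun (congrArg Subtype.val h) i))
  map_rel_iff' {π μ} := by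
    refine forall_congr' fun i => ?_
    rw [absLE_reflB_iff (hasAtMostOneZeroCycle_delta π i), delta_reflB_coe, delta_reflB_coe]
    rfl

theorem range_typeBDivEmbedding :
    Set.range (typeBDivEmbedding n k) = {π | ∀ i, π.1 i ∈ Set.range (typeBEmbedding n)} := by
  ext π
  constructor
  · rintro ⟨π, rfl⟩ i
    exact ⟨π.1 i, rfl⟩
  · intro h
    choose μ hμ using h
    refine ⟨⟨μ, fun i j hij => (typeBEmbedding n).map_rel_iff.1 ?_⟩, Subtype.ext (funext hμ)⟩
    rw [hμ, hμ]
    exact π.2 i j hij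

end NoncrossingTypeB

section TypeBMap

namespace NCGroupDiv

variable {N k : ℕ} (π : NCGroupDiv (reflA N) (cyc N) k)

theorem isMultichain : IsMultichain fun i => (π.1 i).1 :=
  ⟨fun i => (π.1 i).belowCyc, π.2⟩

theorem belowCyc_nablaPerm : BelowCyc (nablaPerm fun i => (π.1 i).1) :=
  (isMultichain_iff _).1 π.isMultichain

theorem noncrossing_shuffleDelta : Noncrossing (shuffleDelta π) := by
  rw [shuffleDelta, π.isMultichain.shuffleFin_classicalDelta]
  exact π.belowCyc_nablaPerm.inv_mul_cyc.noncrossing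

theorem nabla_eq : nabla π = orbitPartition (nablaPerm fun i => (π.1 i).1) := by
  rw [nabla, shuffleDelta, π.isMultichain.shuffleFin_classicalDelta,
    π.belowCyc_nablaPerm.krewerasInv_eq]

theorem nabla_le_nabla_iff {π μ : NCGroupDiv (reflA N) (cyc N) k} :
    nabla π ≤ nabla μ ↔ π ≤ μ := by
  rw [nabla_eq, nabla_eq,
    orbitPartition_nablaPerm_le_iff π.belowCyc_nablaPerm μ.belowCyc_nablaPerm]
  rfl

theorem nabla_injective : Function.Injective (nabla (N := N) (k := k)) := by
  intro π μ h
  rw [nabla_eq, nabla_eq] at h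
  have hnabla := π.belowCyc_nablaPerm.eq_of_orbitPartition_eq μ.belowCyc_nablaPerm h
  have hquotient := shufflePerm_injective (inv_injective (mul_left_cancel hnabla))
  exact Subtype.ext (funext fun i => Subtype.ext (congrFun (quotientSeq_injective hquotient) i))

end NCGroupDiv

variable {n k : ℕ}

theorem centrallySymmetric_nablaPerm_iff {π : Fin k → Equiv.Perm (Fin (2 * n))}
    (h : BelowCyc (nablaPerm π)) :
    CentrallySymmetric (orbitPartition (nablaPerm π)) ↔ ∀ i, π i ∈ signedPerm n := by
  have hhalf : 2 * n * k / 2 = k * n := by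
    rw [mul_assoc, Nat.mul_div_cancel_left _ two_pos, mul_comm]
  have hantipode : antipode (2 * n * k) = cyc (2 * n * k) ^ (k * n) :=
    congrArg (cyc (2 * n * k) ^ ·) hhalf
  rw [CentrallySymmetric, hantipode, ← h.commute_iff ((Commute.refl _).pow_left _),
    commute_nablaPerm_iff]
  simp only [mem_signedPerm, antipode_eq]

/-- The restriction of the type `A` map to `NC^{(k)}(B_n)`. -/
noncomputable def typeBMap (n k : ℕ) (π : NCGroupDiv (reflB n) (cycB n) k) : NCSymDiv n k :=
  ⟨nabla (typeBDivEmbedding n k π), by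
    have hbelow := (typeBDivEmbedding n k π).belowCyc_nablaPerm
    rw [NCGroupDiv.nabla_eq]
    exact ⟨hbelow.noncrossing, (centrallySymmetric_nablaPerm_iff hbelow).2 fun i => (π.1 i).1.2,
      divisible_orbitPartition_nablaPerm _⟩⟩

theorem typeBMap_le_iff {π μ : NCGroupDiv (reflB n) (cycB n) k} :
    typeBMap n k π ≤ typeBMap n k μ ↔ π ≤ μ :=
  NCGroupDiv.nabla_le_nabla_iff.trans (typeBDivEmbedding n k).map_rel_iff

theorem typeBMap_bijective : Function.Bijective (typeBMap n k) := by
  refine ⟨fun π μ h => (typeBDivEmbedding n k).injective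
    (NCGroupDiv.nabla_injective (congrArg Subtype.val h)), ?_⟩
  rintro ⟨P, hP, hsymmetric, hdivisible⟩
  obtain ⟨π, hπ, rfl⟩ := exists_orbitPartition_nablaPerm_eq hP hdivisible
  have hsigned := (centrallySymmetric_nablaPerm_iff hπ).1 hsymmetric
  obtain ⟨hbelow, hmono⟩ := (isMultichain_iff _).2 hπ
  refine ⟨⟨fun i => ⟨⟨π i, hsigned i⟩, absLE_one_left _ _, absLE_cycB_iff.2 (hbelow i)⟩,
    fun i j hij => absLE_reflB_of_reflA (hmono i j hij)⟩, Subtype.ext ?_⟩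
  exact NCGroupDiv.nabla_eq _

end TypeBMap

end KDiv

theorem mainTheorem10 (n k : ℕ) (hn : 0 < n) (hk : 0 < k) :
    -- `NC(B_n)` is the sublattice of `NC(A_{2n-1})` fixed under conjugation by `c ^ n`
    ∃ ι : NCGroup (reflB n) (cycB n) ↪o NCGroup (reflA (2 * n)) (cyc (2 * n)),
      (∀ w, (ι w).1 = (w.1 : Equiv.Perm (Fin (2 * n)))) ∧
      (Set.range ι = {w | cyc (2 * n) ^ n * w.1 * (cyc (2 * n) ^ n)⁻¹ = w.1}) ∧
      (∀ u v, ∃ m j, IsGLB {ι u, ι v} (ι m) ∧ IsLUB {ι u, ι v} (ι j)) ∧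
    -- correspondingly, `NC^{(k)}(B_n)` is an induced subposet of `NC^{(k)}(A_{2n-1})`
    ∃ ιk : NCGroupDiv (reflB n) (cycB n) k ↪o NCGroupDiv (reflA (2 * n)) (cyc (2 * n)) k,
      (∀ π i, (ιk π).1 i = ι (π.1 i)) ∧
      (Set.range ιk = {π | ∀ i, π.1 i ∈ Set.range ι}) ∧
    -- the restriction of the type `A` map is an isomorphism
    ∃ Φ : NCGroupDiv (reflB n) (cycB n) k ≃o NCSymDiv n k,
      ∀ π, Noncrossing (shuffleDelta (ιk π)) ∧ (Φ π).1 = nabla (ιk π) := by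
  refine ⟨typeBEmbedding n, fun _ => rfl,
    Set.ext fun _ => mem_range_typeBEmbedding.trans mem_signedPerm_iff_conj, fun u v => ?_,
    typeBDivEmbedding n k, fun _ _ => rfl, range_typeBDivEmbedding,
    ⟨Equiv.ofBijective _ typeBMap_bijective, typeBMap_le_iff⟩,
    fun _ => ⟨NCGroupDiv.noncrossing_shuffleDelta _, rfl⟩⟩
  obtain ⟨m, hm⟩ := exists_isGLB_typeBEmbedding u v
  obtain ⟨j, hj⟩ := exists_isLUB_typeBEmbedding u v
  exact ⟨m, j, hm, hj⟩
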